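/- Let $q$ be a complex number with $|q|<1$. Put $$E(q):=\prod_{n=1}^{\infty}(1-q^n),\qquad \varphi(q):=\sum_{n=-\infty}^{\infty}q^{n^2},$$ $$P(q):=\frac{E(q^2)E(q^3)E(q^8)E(q^{12})}{E(q)E(q^{24})},\qquad Q(q):=q\,\frac{E(q)E(q^4)E(q^6)E(q^{24})}{E(q^3)E(q^8)}.$$ Let $\left(\frac{-6}{n}\right)$ denote the Kronecker symbol and $\left(\frac{n}{3}\right)$ the Legendre symbol (equal to $0$ when $3\mid n$). In the bilateral series below, for $q=0$ the terms with $n<0$ are understood as their limits as $q\to0$, which are $0$. Then all the series below converge absolutely, $$P(q)=\sum_{n=-\infty}^{\infty}\frac{q^n+q^{5n}}{1+q^{12n}}=1+\sum_{n=1}^{\infty}\left(\frac{-6}{n}\right)\frac{q^n}{1-q^n},$$ $$Q(q)=\sum_{n=-\infty}^{\infty}\frac{q^{3n+1}-q^{9n+3}}{1+q^{12n+4}}=\sum_{n=1}^{\infty}\left(\frac{n}{3}\right)\frac{q^n(1-q^{2n})}{1+q^{4n}}.$$ Moreover, $$\begin{aligned}\varphi(q)\varphi(q^6)&=P(q)+Q(q)\\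 &=\sum_{n=-\infty}^{\infty}\frac{q^n+q^{5n}}{1+q^{12n}}+\sum_{n=-\infty}^{\infty}\frac{q^{3n+1}-q^{9n+3}}{1+q^{12n+4}}\\ &=2\left\{\sum_{n=-\infty}^{\infty}\frac{q^n}{1+q^{12n}}-\sum_{n=-\infty}^{\infty}\frac{q^{9n+3}}{1+q^{12n+4}}\right\}\\ &=2\left\{\sum_{n=-\infty}^{\infty}\frac{q^{5n}}{1+q^{12n}}+\sum_{n=-\infty}^{\infty}\frac{q^{3n+1}}{1+q^{12n+4}}\right\}\\ &=1+\sum_{n=1}^{\infty}\left(\frac{-6}{n}\right)\frac{q^n}{1-q^n}+\sum_{n=1}^{\infty}\left(\frac{n}{3}\right)\frac{q^n(1-q^{2n})}{1+q^{4n}}\end{aligned}$$ and $$\begin{aligned}\varphi(q^2)\varphi(q^3)&=P(q)-Q(q)\\ &=\sum_{n=-\infty}^{\infty}\frac{q^n+q^{5n}}{1+q^{12n}}-\sum_{n=-\infty}^{\infty}\frac{q^{3n+1}-q^{9n+3}}{1+q^{12n+4}}\\ &=2\left\{\sum_{n=-\infty}^{\infty}\frac{q^n}{1+q^{12n}}-\sum_{n=-\infty}^{\infty}\frac{q^{3n+1}}{1+q^{12n+4}}\right\}\\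 &=2\left\{\sum_{n=-\infty}^{\infty}\frac{q^{5n}}{1+q^{12n}}+\sum_{n=-\infty}^{\infty}\frac{q^{9n+3}}{1+q^{12n+4}}\right\}\\ &=1+\sum_{n=1}^{\infty}\left(\frac{-6}{n}\right)\frac{q^n}{1-q^n}-\sum_{n=1}^{\infty}\left(\frac{n}{3}\right)\frac{q^n(1-q^{2n})}{1+q^{4n}}.\end{aligned}$$ -/

import Mathlib

namespace ThetaLambert

/-- The `q`-shifted factorial `(a; q)_∞ = ∏_{n ≥ 0} (1 - a q^n)`. -/
noncomputable def qPoch (a q : ℂ) : ℂ := ∏' n : ℕ, (1 - a * q ^ n)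

/-- Euler's product `E(q) = (q; q)_∞`. -/
noncomputable def E (q : ℂ) : ℂ := qPoch q q

/-- Ramanujan's general theta function
`f(a, b) = ∑_{n ∈ ℤ} a^{n(n+1)/2} b^{n(n-1)/2}`; both exponents are nonnegative integers
and the integer divisions are exact. -/
noncomputable def ramanujanTheta (a b : ℂ) : ℂ :=
  ∑' n : ℤ, a ^ (n * (n + 1) / 2) * b ^ (n * (n - 1) / 2)

/-- Ramanujan's theta function `φ(q) = f(q, q)`. -/
noncomputable def phi (q : ℂ) : ℂ := ramanujanTheta q q

/-- The Kronecker symbol `(a / n)` for `n ≥ 1`: the product over the prime factors `p` of `n`,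
with multiplicity, of the Legendre symbol `(a / p)` if `p` is odd, and of
`(a / 2) = 0, 1, -1` according as `a` is even, `a ≡ ±1 (mod 8)`, `a ≡ ±3 (mod 8)`, if `p = 2`. -/
def kronecker (a : ℤ) (n : ℕ) : ℤ :=
  (n.primeFactorsList.pmap
    (fun p pp => if p = 2 then ZMod.χ₈ (a : ZMod 8) else @legendreSym p ⟨pp⟩ a)
    fun _ pf => Nat.prime_of_mem_primeFactorsList pf).prod

/-- The eta-quotient `P(q) = E(q²)E(q³)E(q⁸)E(q¹²) / (E(q)E(q²⁴))`. -/
noncomputable def P (q : ℂ) : ℂ :=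
  E (q ^ 2) * E (q ^ 3) * E (q ^ 8) * E (q ^ 12) / (E q * E (q ^ 24))

/-- The eta-quotient `Q(q) = q E(q)E(q⁴)E(q⁶)E(q²⁴) / (E(q³)E(q⁸))`. -/
noncomputable def Q (q : ℂ) : ℂ :=
  q * (E q * E (q ^ 4) * E (q ^ 6) * E (q ^ 24)) / (E (q ^ 3) * E (q ^ 8))

/-! The infinite product and the theta series above converge, and the denominators of the
eta-quotients do not vanish, for `|q| < 1`. -/

theorem multipliable_E {q : ℂ} (hq : ‖q‖ < 1) : Multipliable fun n : ℕ => 1 - q * q ^ n := by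
  simpa [pow_succ'] using ModularForm.multipliable_one_sub_pow hq

theorem E_ne_zero {q : ℂ} (hq : ‖q‖ < 1) : E q ≠ 0 := by
  unfold E qPoch
  simp only [sub_eq_add_neg]
  refine tprod_one_add_ne_zero_of_summable (f := fun n : ℕ => -(q * q ^ n)) (fun n => ?_) ?_
  · intro h
    have h1 : q ^ (n + 1) = 1 := by rw [pow_succ']; linear_combination -h
    have h2 : ‖q‖ ^ (n + 1) = 1 := by rw [← norm_pow, h1, norm_one]
    exact absurd h2 (pow_lt_one₀ (norm_nonneg _) hq (Nat.succ_ne_zero n)).ne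
  · simpa using (summable_geometric_of_lt_one (norm_nonneg _) hq).mul_left ‖q‖

theorem phi_term (q : ℂ) (n : ℤ) :
    q ^ (n * (n + 1) / 2) * q ^ (n * (n - 1) / 2) = q ^ n.natAbs ^ 2 := by
  obtain ⟨k, hk⟩ := Int.even_mul_succ_self n
  obtain ⟨l, hl⟩ := Int.even_mul_pred_self n
  have hk' : n * (n + 1) / 2 = k := by omega
  have hl' : n * (n - 1) / 2 = l := by omega
  have hk0 : 0 ≤ k := by
    rcases le_or_gt 0 n with h | h <;> nlinarith
  have hl0 : 0 ≤ l := by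
    rcases le_or_gt n 0 with h | h <;> nlinarith
  have hs : ((n.natAbs ^ 2 : ℕ) : ℤ) = k + l := by
    push_cast
    rw [sq_abs]
    nlinarith
  rw [hk', hl']
  lift k to ℕ using hk0
  lift l to ℕ using hl0
  rw [zpow_natCast, zpow_natCast, ← pow_add]
  congr 1
  exact_mod_cast hs.symm

theorem summable_phi {q : ℂ} (hq : ‖q‖ < 1) :
    Summable fun n : ℤ => q ^ (n * (n + 1) / 2) * q ^ (n * (n - 1) / 2) := by
  simp only [phi_term]
  have h : Summable fun n : ℕ => q ^ n ^ 2 := by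
    refine Summable.of_norm_bounded (summable_geometric_of_lt_one (norm_nonneg q) hq) fun n => ?_
    rw [norm_pow]
    exact pow_le_pow_of_le_one (norm_nonneg _) hq.le (Nat.le_self_pow two_ne_zero n)
  refine Summable.of_nat_of_neg ?_ ?_ <;> simpa using h

theorem phi_eq_tsum (q : ℂ) : phi q = ∑' n : ℤ, q ^ n.natAbs ^ 2 :=
  tsum_congr (phi_term q)

end ThetaLambert

namespace ThetaLambert

open Filter Topology

/-! ### Triangular exponents -/

/-! Write A = φ(q)φ(q⁶) and B = φ(q²)φ(q³). The identities A = P + Q and B = P − Q follow from two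
quadratic relations, A² − B² = 4PQ (`phi_sq_sub_phi_sq`) and AB = P² − Q² (`phi_mul_phi`). For c =
±i they say that A + cB and (P + Q) + c(P − Q) have the same square. Both are analytic on the unit
disc and equal 1 + c ≠ 0 at q = 0, so they coincide (`eq_of_sq_eq_of_eq_at_zero`), and the two
choices of c give A and B. The quadratic relations come from parity dissections of theta series and
of products of two theta series, turned into eta quotients by the Jacobi triple product.

The bilateral series for P and Q are instances of Kronecker's formula `bilateral_eq`, with p = q¹²
and a = −1 or a = −q⁴. The theta quotients that arise are combined by `J_mul_J_add` for P and by a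
dissection of the pentagonal series, `J_twelve_sub`, for Q.

With S₁, S₅, T₃, T₉ the four series with a single power of q in the numerator, P = S₁ + S₅ and Q =
T₃ − T₉. The forms of A and B with the factor 2 need only S₁ − S₅ = T₃ + T₉ (`tsum_sub_eq_add`),
which follows from 1 + y¹² = (1 + y⁴)(1 − y⁴ + y⁸).

The Lambert series come from expanding in a character: (−6/·) is antiperiodic modulo 12, which
produces the denominators 1 + q¹²ⁿ, and the odd character (·/3) pairs n with −n. -/

theorem two_mul_tri (n : ℤ) : 2 * (n * (n - 1) / 2) = n * (n - 1) :=
  Int.mul_ediv_cancel' (Int.even_mul_pred_self n).two_dvd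

theorem tri_succ (n : ℤ) : (n + 1) * (n + 1 - 1) / 2 = n * (n - 1) / 2 + n := by
  have h1 := two_mul_tri n
  have h2 := two_mul_tri (n + 1)
  have h3 : (n + 1) * (n + 1 - 1) = n * (n - 1) + 2 * n := by ring
  omega

theorem tri_neg_succ (n : ℤ) :
    (-(n + 1)) * (-(n + 1) - 1) / 2 = (-n) * (-n - 1) / 2 + (n + 1) := by
  have h1 := two_mul_tri (-n)
  have h2 := two_mul_tri (-(n + 1))
  have h3 : (-(n + 1)) * (-(n + 1) - 1) = (-n) * (-n - 1) + 2 * (n + 1) := by ring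
  omega

/-- The theta series `∑_{n ∈ ℤ} q^{n(n-1)/2} z^n`. -/
noncomputable def J (q z : ℂ) : ℂ := ∑' n : ℤ, q ^ (n * (n - 1) / 2) * z ^ n

theorem summable_J {q z : ℂ} (hq0 : q ≠ 0) (hq : ‖q‖ < 1) (hz : z ≠ 0) :
    Summable fun n : ℤ => q ^ (n * (n - 1) / 2) * z ^ n := by
  have hpow : Tendsto (fun n : ℕ => ‖q‖ ^ n) atTop (𝓝 0) :=
    tendsto_pow_atTop_nhds_zero_of_lt_one (norm_nonneg _) hq
  have hne : ∀ n : ℤ, q ^ (n * (n - 1) / 2) * z ^ n ≠ 0 := fun n =>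
    mul_ne_zero (zpow_ne_zero _ hq0) (zpow_ne_zero _ hz)
  refine Summable.of_nat_of_neg ?_ ?_
  · refine summable_of_ratio_test_tendsto_lt_one zero_lt_one (.of_forall fun n => hne n) ?_
    have h : (fun n : ℕ => ‖q ^ (((n + 1 : ℕ) : ℤ) * (((n + 1 : ℕ) : ℤ) - 1) / 2) *
        z ^ ((n + 1 : ℕ) : ℤ)‖ / ‖q ^ ((n : ℤ) * ((n : ℤ) - 1) / 2) * z ^ (n : ℤ)‖) =
        fun n : ℕ => ‖q‖ ^ n * ‖z‖ := by
      ext n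
      rw [← norm_div, (div_eq_iff (c := q ^ n * z) (hne n)).mpr]
      · simp
      · push_cast
        rw [tri_succ, zpow_add₀ hq0, zpow_add_one₀ hz, zpow_natCast q n]
        ring
    rw [h]
    simpa using hpow.mul_const ‖z‖
  · refine summable_of_ratio_test_tendsto_lt_one zero_lt_one (.of_forall fun n => hne _) ?_
    have h : (fun n : ℕ => ‖q ^ ((-((n + 1 : ℕ) : ℤ)) * (-((n + 1 : ℕ) : ℤ) - 1) / 2) *
        z ^ (-((n + 1 : ℕ) : ℤ))‖ / ‖q ^ ((-(n : ℤ)) * (-(n : ℤ) - 1) / 2) * z ^ (-(n : ℤ))‖) =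
        fun n : ℕ => ‖q‖ ^ n * ‖q / z‖ := by
      ext n
      rw [← norm_div, (div_eq_iff (c := q ^ n * (q / z)) (hne _)).mpr]
      · simp
      · push_cast
        rw [tri_neg_succ, zpow_add₀ hq0, neg_add, zpow_add₀ hz, zpow_add₀ hq0, zpow_natCast q n]
        simp
        ring
    rw [h]
    simpa using hpow.mul_const ‖q / z‖

/-! ### The `q`-shifted factorial -/

theorem summable_mul_pow (a : ℂ) {q : ℂ} (hq : ‖q‖ < 1) :
    Summable fun n : ℕ => ‖-(a * q ^ n)‖ := by
  simpa using (summable_geometric_of_lt_one (norm_nonneg _) hq).mul_left ‖a‖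

theorem multipliable_qPoch (a : ℂ) {q : ℂ} (hq : ‖q‖ < 1) :
    Multipliable fun n : ℕ => 1 - a * q ^ n := by
  simpa only [sub_eq_add_neg] using multipliable_one_add_of_summable (summable_mul_pow a hq)

theorem tendsto_qPoch (a : ℂ) {q : ℂ} (hq : ‖q‖ < 1) :
    Tendsto (fun N : ℕ => ∏ n ∈ Finset.range N, (1 - a * q ^ n)) atTop (𝓝 (qPoch a q)) :=
  (multipliable_qPoch a hq).hasProd.tendsto_prod_nat

theorem qPoch_eq_mul (a : ℂ) {q : ℂ} (hq : ‖q‖ < 1) :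
    qPoch a q = (1 - a) * qPoch (a * q) q := by
  have h1 := (tendsto_qPoch a hq).comp (tendsto_add_atTop_nat 1)
  have h2 := (tendsto_qPoch (a * q) hq).const_mul (1 - a)
  refine tendsto_nhds_unique h1 (h2.congr fun N => ?_)
  simp only [Function.comp, Finset.prod_range_succ']
  simp [pow_succ', mul_assoc, mul_comm]

theorem qPoch_one {q : ℂ} (hq : ‖q‖ < 1) : qPoch 1 q = 0 := by
  rw [qPoch_eq_mul 1 hq]; simp

/-- Near `a` the factors are dominated by a geometric series. Continuity in `a` is what allows the
limit x → 1 in Kronecker's formula. -/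
theorem continuous_qPoch {q : ℂ} (hq : ‖q‖ < 1) : Continuous fun a => qPoch a q := by
  rw [continuous_iff_continuousAt]
  intro a
  have := tendsto_tprod_one_add_of_dominated_convergence (𝓕 := 𝓝 a)
    (f := fun b (n : ℕ) => -(b * q ^ n)) (g := fun n => -(a * q ^ n))
    (bound := fun n => (‖a‖ + 1) * ‖q‖ ^ n)
    ((summable_geometric_of_lt_one (norm_nonneg _) hq).mul_left _)
    (fun n => (by fun_prop : Continuous fun b : ℂ => -(b * q ^ n)).tendsto a) ?_
  · simp only [← sub_eq_add_neg] at this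
    exact this
  · have h : ∀ᶠ b in 𝓝 a, ‖b‖ < ‖a‖ + 1 :=
      continuous_norm.continuousAt.eventually_lt continuousAt_const (by simp)
    filter_upwards [h] with b hb n
    rw [norm_neg, norm_mul, norm_pow]
    gcongr

theorem qPoch_split_two (a : ℂ) {q : ℂ} (hq : ‖q‖ < 1) :
    qPoch a q = qPoch a (q ^ 2) * qPoch (a * q) (q ^ 2) := by
  have hq2 : ‖q ^ 2‖ < 1 := by rw [norm_pow]; exact pow_lt_one₀ (norm_nonneg _) hq two_ne_zero
  have h1 := (tendsto_qPoch a hq).comp (tendsto_id.nsmul_atTop (n := 2) two_pos)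
  have h2 := (tendsto_qPoch a hq2).mul (tendsto_qPoch (a * q) hq2)
  refine tendsto_nhds_unique h1 (h2.congr fun N => ?_)
  simp only [Function.comp, id, smul_eq_mul]
  induction N with
  | zero => simp
  | succ N ih =>
    rw [mul_add_one, Finset.prod_range_succ, Finset.prod_range_succ, Finset.prod_range_succ,
      Finset.prod_range_succ, ← ih]
    ring

theorem qPoch_split_three (a : ℂ) {q : ℂ} (hq : ‖q‖ < 1) :
    qPoch a q = qPoch a (q ^ 3) * qPoch (a * q) (q ^ 3) * qPoch (a * q ^ 2) (q ^ 3) := by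
  have hq2 : ‖q ^ 3‖ < 1 := by rw [norm_pow]; exact pow_lt_one₀ (norm_nonneg _) hq three_ne_zero
  have h1 := (tendsto_qPoch a hq).comp (tendsto_id.nsmul_atTop (n := 3) three_pos)
  have h2 := ((tendsto_qPoch a hq2).mul (tendsto_qPoch (a * q) hq2)).mul
    (tendsto_qPoch (a * q ^ 2) hq2)
  refine tendsto_nhds_unique h1 (h2.congr fun N => ?_)
  simp only [Function.comp, id, smul_eq_mul]
  induction N with
  | zero => simp
  | succ N ih =>
    rw [mul_add_one, Finset.prod_range_succ, Finset.prod_range_succ, Finset.prod_range_succ,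
      Finset.prod_range_succ, Finset.prod_range_succ, Finset.prod_range_succ, ← ih]
    ring

theorem qPoch_mul_qPoch_neg (a : ℂ) {q : ℂ} (hq : ‖q‖ < 1) :
    qPoch a q * qPoch (-a) q = qPoch (a ^ 2) (q ^ 2) := by
  rw [qPoch, qPoch, qPoch, ← (multipliable_qPoch a hq).tprod_mul (multipliable_qPoch (-a) hq)]
  refine tprod_congr fun n => ?_
  ring

/-! ### The Jacobi triple product -/

/-- `1 / (q; q)_n`, extended by zero to negative `n`. -/
noncomputable def invFac (q : ℂ) (n : ℤ) : ℂ :=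
  if 0 ≤ n then (∏ i ∈ Finset.range n.toNat, (1 - q * q ^ i))⁻¹ else 0

theorem one_sub_mul_pow_ne_zero {q : ℂ} (hq : ‖q‖ < 1) (n : ℕ) : 1 - q * q ^ n ≠ 0 := by
  intro h
  have h1 : q ^ (n + 1) = 1 := by rw [pow_succ']; linear_combination -h
  have h2 : ‖q‖ ^ (n + 1) = 1 := by rw [← norm_pow, h1, norm_one]
  exact absurd h2 (pow_lt_one₀ (norm_nonneg _) hq (Nat.succ_ne_zero n)).ne

/-- Extension by zero respects the recurrence at n = 0 because the factor 1 − q⁰ vanishes; no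
boundary terms appear in the finite triple product. -/
theorem invFac_sub_one {q : ℂ} (hq : ‖q‖ < 1) (n : ℤ) :
    invFac q (n - 1) = (1 - q ^ n) * invFac q n := by
  rcases lt_trichotomy n 0 with h | rfl | h
  · rw [invFac, invFac, if_neg (by omega), if_neg (by omega), mul_zero]
  · simp [invFac]
  · obtain ⟨k, rfl⟩ : ∃ k : ℕ, n = k + 1 := ⟨(n - 1).toNat, by omega⟩
    have hk := one_sub_mul_pow_ne_zero hq k
    rw [invFac, invFac, if_pos (by omega), if_pos (by omega)]
    have e1 : ((k : ℤ) + 1 - 1).toNat = k := by omega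
    have e2 : ((k : ℤ) + 1).toNat = k + 1 := by omega
    have e3 : q ^ ((k : ℤ) + 1) = q * q ^ k := by
      rw [← Nat.cast_succ, zpow_natCast, pow_succ']
    rw [e1, e2, e3, Finset.prod_range_succ, mul_inv, mul_left_comm, mul_inv_cancel₀ hk, mul_one]

theorem tendsto_invFac {q : ℂ} (hq : ‖q‖ < 1) :
    Tendsto (fun n : ℕ => invFac q n) atTop (𝓝 (E q)⁻¹) := by
  have h := (tendsto_qPoch q hq).inv₀ (E_ne_zero hq)
  refine h.congr fun n => ?_
  simp [invFac]

theorem exists_norm_invFac_le {q : ℂ} (hq : ‖q‖ < 1) : ∃ C : ℝ, 0 ≤ C ∧ ∀ n, ‖invFac q n‖ ≤ C := by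
  obtain ⟨C, hC⟩ := (tendsto_invFac hq).norm.bddAbove_range
  have hC0 : 0 ≤ C := (norm_nonneg _).trans (hC ⟨0, rfl⟩)
  refine ⟨C, hC0, fun n => ?_⟩
  rcases le_or_gt 0 n with h | h
  · lift n to ℕ using h
    exact hC ⟨n, rfl⟩
  · rw [invFac, if_neg (by omega), norm_zero]; exact hC0

/-- This is the q-binomial theorem in symmetric form. Passing from N to N + 1 multiplies by (1 +
zq^N)(1 + q^(N+1)/z), whose expansion has a constant part and two parts that shift j by one. -/
theorem finite_triple_product {q z : ℂ} (hq0 : q ≠ 0) (hq : ‖q‖ < 1) (hz : z ≠ 0) (N : ℕ) :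
    HasSum (fun j : ℤ => (∏ i ∈ Finset.range (2 * N), (1 - q * q ^ i)) *
        (invFac q (N + j) * invFac q (N - j)) * (q ^ (j * (j - 1) / 2) * z ^ j))
      ((∏ i ∈ Finset.range N, (1 - (-z) * q ^ i)) *
        ∏ i ∈ Finset.range N, (1 - (-q / z) * q ^ i)) := by
  induction N with
  | zero =>
    convert hasSum_ite_eq (0 : ℤ) (1 : ℂ) using 2 with j
    · split_ifs with hj
      · simp [hj, invFac]
      · rcases lt_or_gt_of_ne hj with h | h
        · simp [invFac, if_neg (not_le.mpr h)]
        · simp [invFac, if_neg (not_le.mpr h)]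
    · simp
  | succ N ih =>
    have hs1 := (Equiv.addRight (-1 : ℤ)).hasSum_iff.mpr ih
    have hs2 := (Equiv.addRight (1 : ℤ)).hasSum_iff.mpr ih
    have h := ((ih.mul_left (1 + q ^ (2 * N + 1))).add (hs1.mul_left (z * q ^ N))).add
      (hs2.mul_left (q ^ (N + 1) / z))
    have hval : (1 + q ^ (2 * N + 1)) * ((∏ i ∈ Finset.range N, (1 - -z * q ^ i)) *
          ∏ i ∈ Finset.range N, (1 - -q / z * q ^ i)) +
        z * q ^ N * ((∏ i ∈ Finset.range N, (1 - -z * q ^ i)) *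
          ∏ i ∈ Finset.range N, (1 - -q / z * q ^ i)) +
        q ^ (N + 1) / z * ((∏ i ∈ Finset.range N, (1 - -z * q ^ i)) *
          ∏ i ∈ Finset.range N, (1 - -q / z * q ^ i)) =
        (∏ i ∈ Finset.range (N + 1), (1 - -z * q ^ i)) *
          ∏ i ∈ Finset.range (N + 1), (1 - -q / z * q ^ i) := by
      rw [Finset.prod_range_succ, Finset.prod_range_succ]
      field_simp
      ring
    rw [← hval]
    refine h.congr_fun fun j => ?_
    simp only [Function.comp, Equiv.coe_addRight]
    -- All reciprocal factorials are expressed through those at N + 1 + j and N + 1 − j, which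
    -- leaves an algebraic identity in q^N, q^j and z^j.
    have a1 : invFac q (N + j) = (1 - q ^ ((N : ℤ) + 1 + j)) * invFac q (N + 1 + j) := by
      rw [← invFac_sub_one hq]; congr 1; ring
    have a2 : invFac q (N + (j + -1)) =
        (1 - q ^ ((N : ℤ) + j)) * ((1 - q ^ ((N : ℤ) + 1 + j)) * invFac q (N + 1 + j)) := by
      rw [← a1, ← invFac_sub_one hq]; congr 1; ring
    have a3 : invFac q (N + (j + 1)) = invFac q (N + 1 + j) := by congr 1; ring
    have b1 : invFac q (N - j) = (1 - q ^ ((N : ℤ) + 1 - j)) * invFac q (N + 1 - j) := by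
      rw [← invFac_sub_one hq]; congr 1; ring
    have b2 : invFac q (N - (j + 1)) =
        (1 - q ^ ((N : ℤ) - j)) * ((1 - q ^ ((N : ℤ) + 1 - j)) * invFac q (N + 1 - j)) := by
      rw [← b1, ← invFac_sub_one hq]; congr 1; ring
    have b3 : invFac q (N - (j + -1)) = invFac q (N + 1 - j) := by congr 1; ring
    have t2 : (j + 1) * (j + 1 - 1) / 2 = j * (j - 1) / 2 + j := tri_succ j
    have t1 : (j + -1) * (j + -1 - 1) / 2 = j * (j - 1) / 2 - (j + -1) := by
      have h2 := tri_succ (j + -1)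
      rw [neg_add_cancel_right] at h2
      omega
    rw [a1, a2, a3, b1, b2, b3, t1, t2, mul_add_one, Finset.prod_range_succ,
      Finset.prod_range_succ, zpow_sub₀ hq0, zpow_add₀ hq0 _ j]
    push_cast
    simp only [zpow_add₀ hq0, zpow_sub₀ hq0, zpow_add₀ hz, zpow_one, zpow_natCast, zpow_neg]
    have hqj : q ^ j ≠ 0 := zpow_ne_zero _ hq0
    have hzj : z ^ j ≠ 0 := zpow_ne_zero _ hz
    have hqN : q ^ N ≠ 0 := pow_ne_zero _ hq0
    generalize q ^ (j * (j - 1) / 2) = t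
    generalize invFac q (N + 1 + j) = u
    generalize invFac q (N + 1 - j) = v
    generalize (∏ i ∈ Finset.range (2 * N), (1 - q * q ^ i)) = w
    have e : q ^ (2 * N) = q ^ N * q ^ N := by ring
    simp only [pow_succ, e]
    generalize q ^ N = y at *
    generalize q ^ j = x at *
    generalize z ^ j = s at *
    field_simp
    ring

/-- Let N → ∞ in the finite identity. The coefficients are uniformly bounded, so dominated
convergence applies. -/
theorem jacobi_triple_product {q z : ℂ} (hq0 : q ≠ 0) (hq : ‖q‖ < 1) (hz : z ≠ 0) :
    J q z = E q * qPoch (-z) q * qPoch (-q / z) q := by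
  have hE := E_ne_zero hq
  obtain ⟨C, hC0, hC⟩ := exists_norm_invFac_le hq
  obtain ⟨D, hD⟩ := (tendsto_qPoch q hq).norm.bddAbove_range
  have hD' : ∀ n : ℕ, ‖∏ i ∈ Finset.range n, (1 - q * q ^ i)‖ ≤ D := fun n => hD ⟨n, rfl⟩
  have hD0 : 0 ≤ D := (norm_nonneg _).trans (hD' 0)
  have h2N : Tendsto (fun N : ℕ => 2 * N) atTop atTop := tendsto_id.nsmul_atTop (n := 2) two_pos
  have hlim : Tendsto (fun N : ℕ => ∑' j : ℤ, (∏ i ∈ Finset.range (2 * N), (1 - q * q ^ i)) *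
        (invFac q (N + j) * invFac q (N - j)) * (q ^ (j * (j - 1) / 2) * z ^ j)) atTop
      (𝓝 (∑' j : ℤ, (E q)⁻¹ * (q ^ (j * (j - 1) / 2) * z ^ j))) := by
    refine tendsto_tsum_of_dominated_convergence
      (bound := fun j : ℤ => D * (C * C) * ‖q ^ (j * (j - 1) / 2) * z ^ j‖)
      ((summable_J hq0 hq hz).norm.mul_left _) (fun j => ?_) (.of_forall fun N j => ?_)
    · refine Tendsto.mul_const _ ?_
      have e : (E q)⁻¹ = E q * ((E q)⁻¹ * (E q)⁻¹) := by field_simp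
      rw [e]
      refine ((tendsto_qPoch q hq).comp h2N).mul (Tendsto.mul ?_ ?_)
      · have : Tendsto (fun N : ℕ => ((N : ℤ) + j).toNat) atTop atTop :=
          tendsto_atTop.mpr fun b => by
            filter_upwards [eventually_ge_atTop (b + j.natAbs)] with N hN
            omega
        refine ((tendsto_invFac hq).comp this).congr' ?_
        filter_upwards [eventually_ge_atTop j.natAbs] with N hN
        simp only [Function.comp]
        congr 1
        omega
      · have : Tendsto (fun N : ℕ => ((N : ℤ) - j).toNat) atTop atTop :=
          tendsto_atTop.mpr fun b => by
            filter_upwards [eventually_ge_atTop (b + j.natAbs)] with N hN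
            omega
        refine ((tendsto_invFac hq).comp this).congr' ?_
        filter_upwards [eventually_ge_atTop j.natAbs] with N hN
        simp only [Function.comp]
        congr 1
        omega
    · rw [norm_mul, norm_mul, norm_mul (invFac q _)]
      gcongr
      · exact hD' _
      · exact hC _
      · exact hC _
  have hprod := (tendsto_qPoch (-z) hq).mul (tendsto_qPoch (-q / z) hq)
  have h := tendsto_nhds_unique
    (hlim.congr fun N => (finite_triple_product hq0 hq hz N).tsum_eq) hprod
  rw [tsum_mul_left, inv_mul_eq_iff_eq_mul₀ hE] at h
  rw [J, h, mul_assoc]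

/-! ### The bilateral series `∑ xⁿ / (1 - a pⁿ)` -/

/-- The reciprocals stay bounded as n → ∞ and decay like pⁿ at index −n; this is why the bilateral
series needs ‖p‖ < ‖x‖ < 1. -/
theorem exists_norm_inv_one_sub_le {a p : ℂ} (ha : a ≠ 0) (hp0 : p ≠ 0) (hp : ‖p‖ < 1) :
    ∃ C : ℝ, 0 ≤ C ∧ (∀ n : ℕ, ‖(1 - a * p ^ (n : ℤ))⁻¹‖ ≤ C) ∧
      ∀ n : ℕ, ‖(1 - a * p ^ (-(n : ℤ)))⁻¹‖ ≤ C * ‖p‖ ^ n := by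
  have hpow : Tendsto (fun n : ℕ => p ^ n) atTop (𝓝 0) := tendsto_pow_atTop_nhds_zero_of_norm_lt_one hp
  have h1 : Tendsto (fun n : ℕ => (1 - a * p ^ n)⁻¹) atTop (𝓝 (1 - a * 0)⁻¹) :=
    ((hpow.const_mul a).const_sub 1).inv₀ (by simp)
  have h2 : Tendsto (fun n : ℕ => (p ^ n - a)⁻¹) atTop (𝓝 (0 - a)⁻¹) :=
    (hpow.sub_const a).inv₀ (by simpa using ha)
  obtain ⟨C, hC⟩ := h1.norm.bddAbove_range
  obtain ⟨D, hD⟩ := h2.norm.bddAbove_range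
  refine ⟨max C D, (norm_nonneg _).trans ((hC ⟨0, rfl⟩).trans (le_max_left _ _)), fun n => ?_,
    fun n => ?_⟩
  · rw [zpow_natCast]; exact (hC ⟨n, rfl⟩).trans (le_max_left _ _)
  · have e : (1 - a * p ^ (-(n : ℤ)))⁻¹ = (p ^ n - a)⁻¹ * p ^ n := by
      have : (p ^ n - a) = p ^ n * (1 - a * p ^ (-(n : ℤ))) := by
        rw [zpow_neg, zpow_natCast]
        field_simp
      rw [this, mul_inv, mul_right_comm, inv_mul_cancel₀ (pow_ne_zero _ hp0), one_mul]
    rw [e, norm_mul, norm_pow]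
    gcongr
    exact (hD ⟨n, rfl⟩).trans (le_max_right _ _)

theorem summable_bilateral_neg {a p x : ℂ} (ha : a ≠ 0) (hp0 : p ≠ 0) (hp : ‖p‖ < 1)
    (hpx : ‖p‖ < ‖x‖) :
    Summable fun n : ℕ => x ^ (-(n : ℤ)) / (1 - a * p ^ (-(n : ℤ))) := by
  obtain ⟨C, hC0, hC1, hC2⟩ := exists_norm_inv_one_sub_le ha hp0 hp
  have hx0 : 0 < ‖x‖ := (norm_nonneg _).trans_lt hpx
  have hr : ‖p‖ / ‖x‖ < 1 := (div_lt_one hx0).mpr hpx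
  refine Summable.of_norm_bounded
    ((summable_geometric_of_lt_one (by positivity) hr).mul_left C) fun n => ?_
  rw [div_eq_mul_inv, norm_mul, norm_zpow, zpow_neg, zpow_natCast, div_pow, mul_comm,
    div_eq_mul_inv, ← mul_assoc]
  gcongr
  exact hC2 n

theorem summable_bilateral {a p x : ℂ} (ha : a ≠ 0) (hp0 : p ≠ 0) (hp : ‖p‖ < 1)
    (hpx : ‖p‖ < ‖x‖) (hx : ‖x‖ < 1) :
    Summable fun n : ℤ => x ^ n / (1 - a * p ^ n) := by
  obtain ⟨C, hC0, hC1, hC2⟩ := exists_norm_inv_one_sub_le ha hp0 hp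
  refine Summable.of_nat_of_neg ?_ (summable_bilateral_neg ha hp0 hp hpx)
  refine Summable.of_norm_bounded
    ((summable_geometric_of_lt_one (norm_nonneg _) hx).mul_left C) fun n => ?_
  rw [div_eq_mul_inv, norm_mul, zpow_natCast, norm_pow, mul_comm]
  gcongr
  exact hC1 n

/-- Removing the geometric series ∑_{n ≥ 0} xⁿ removes the pole at x = 1, so convergence extends to
‖x‖ = 1. -/
theorem summable_bilateral_sub {a p x : ℂ} (ha : a ≠ 0) (hp0 : p ≠ 0) (hp : ‖p‖ < 1)
    (hap : ∀ n : ℤ, 1 - a * p ^ n ≠ 0) (hpx : ‖p‖ < ‖x‖) (hx : ‖x‖ ≤ 1) :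
    Summable fun n : ℤ => x ^ n * ((1 - a * p ^ n)⁻¹ - if 0 ≤ n then 1 else 0) := by
  obtain ⟨C, hC0, hC1, hC2⟩ := exists_norm_inv_one_sub_le ha hp0 hp
  refine Summable.of_nat_of_neg_add_one ?_ ?_
  · refine Summable.of_norm_bounded (g := fun n : ℕ => ‖a‖ * C * ‖p‖ ^ n)
      ((summable_geometric_of_lt_one (norm_nonneg _) hp).mul_left _) fun n => ?_
    have e : (1 - a * p ^ (n : ℤ))⁻¹ - 1 = a * p ^ n * (1 - a * p ^ (n : ℤ))⁻¹ := by
      have := hap n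
      rw [zpow_natCast] at *
      field_simp
      ring
    rw [if_pos (by omega), e, norm_mul, norm_mul, norm_mul, norm_pow, zpow_natCast, norm_pow]
    calc ‖x‖ ^ n * (‖a‖ * ‖p‖ ^ n * ‖(1 - a * p ^ (n : ℤ))⁻¹‖)
        ≤ 1 * (‖a‖ * ‖p‖ ^ n * C) := by
          gcongr
          · exact pow_le_one₀ (norm_nonneg _) hx
          · exact hC1 n
      _ = _ := by ring
  · refine ((summable_nat_add_iff 1).mpr (summable_bilateral_neg ha hp0 hp hpx)).congr fun n => ?_
    rw [if_neg (by omega)]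
    push_cast
    rw [sub_zero, div_eq_mul_inv]

theorem J_neg_one {p : ℂ} (hp0 : p ≠ 0) (hp : ‖p‖ < 1) : J p (-1) = 0 := by
  rw [jacobi_triple_product hp0 hp (by simp), neg_neg, qPoch_one hp]
  simp

/-- The coefficients of the product in powers of x satisfy a first-order recurrence, the one
satisfied by the coefficients of J(p, −ax). Hence the two series are proportional, with a constant
independent of x. -/
theorem exists_J_mul_bilateral {a p : ℂ} (ha : a ≠ 0) (hp0 : p ≠ 0) (hp : ‖p‖ < 1)
    (hap : ∀ n : ℤ, 1 - a * p ^ n ≠ 0) :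
    ∃ d : ℂ, ∀ x : ℂ, ‖p‖ < ‖x‖ → ‖x‖ < 1 →
      J p (-x) * ∑' n : ℤ, x ^ n / (1 - a * p ^ n) = d * J p (-a * x) := by
  obtain ⟨C, hC0, hC1, hC2⟩ := exists_norm_inv_one_sub_le ha hp0 hp
  have hC : ∀ n : ℤ, ‖(1 - a * p ^ n)⁻¹‖ ≤ C := by
    intro n
    obtain ⟨k, rfl | rfl⟩ := n.eq_nat_or_neg
    · exact hC1 k
    · exact (hC2 k).trans (mul_le_of_le_one_right hC0 (pow_le_one₀ (norm_nonneg _) hp.le))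
  have hJ := summable_J hp0 hp (show (-1 : ℂ) ≠ 0 by simp)
  -- the coefficient of `x ^ k`
  set D : ℤ → ℂ := fun k => ∑' m : ℤ, p ^ (m * (m - 1) / 2) * (-1) ^ m * (1 - a * p ^ (k - m))⁻¹
    with hD
  have hs : ∀ k : ℤ, Summable fun m : ℤ =>
      p ^ (m * (m - 1) / 2) * (-1) ^ m * (1 - a * p ^ (k - m))⁻¹ := fun k =>
    Summable.of_norm_bounded (hJ.norm.mul_right C) fun m => by
      rw [norm_mul]
      gcongr
      exact hC _
  have hrec : ∀ k : ℤ, D (k + 1) = -a * p ^ k * D k := by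
    intro k
    -- Subtracting this vanishing series replaces 1/(1 − y) by y/(1 − y), which gives the recurrence
    -- after a shift of m.
    have h0 : ∑' m : ℤ, p ^ (m * (m - 1) / 2) * (-1) ^ m = 0 := J_neg_one hp0 hp
    have h1 : D (k + 1) = ∑' m : ℤ, (p ^ (m * (m - 1) / 2) * (-1) ^ m *
        (1 - a * p ^ (k + 1 - m))⁻¹ - p ^ (m * (m - 1) / 2) * (-1) ^ m) := by
      rw [(hs _).tsum_sub hJ, h0, sub_zero]
    rw [h1, ← (Equiv.addRight (1 : ℤ)).tsum_eq, hD, ← tsum_mul_left]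
    refine tsum_congr fun m => ?_
    have h2 := hap (k - m)
    simp only [Equiv.coe_addRight]
    have e : k + 1 - (m + 1) = k - m := by ring
    rw [tri_succ, e, zpow_add₀ hp0, zpow_add_one₀ (by simp : (-1 : ℂ) ≠ 0)]
    rw [zpow_sub₀ hp0] at h2 ⊢
    have hpm := zpow_ne_zero m hp0
    have e3 : (1 - a * (p ^ k / p ^ m))⁻¹ - 1 =
        a * (p ^ k / p ^ m) * (1 - a * (p ^ k / p ^ m))⁻¹ := by
      generalize p ^ k / p ^ m = y at h2 ⊢
      field_simp
      ring
    calc _ = p ^ (m * (m - 1) / 2) * p ^ m * ((-1) ^ m * -1) *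
          ((1 - a * (p ^ k / p ^ m))⁻¹ - 1) := by ring
      _ = _ := by
        rw [e3]
        field_simp
  have hDk : ∀ k : ℤ, D k = (-a) ^ k * p ^ (k * (k - 1) / 2) * D 0 := by
    have ha' : -a ≠ 0 := neg_ne_zero.mpr ha
    intro k
    induction k using Int.induction_on with
    | zero => simp
    | succ k ih =>
      rw [hrec, ih, tri_succ, zpow_add_one₀ ha', zpow_add₀ hp0]
      ring
    | pred k ih =>
      have h1 := hrec (-(k : ℤ) - 1)
      have h2 := tri_succ (-(k : ℤ) - 1)
      rw [sub_add_cancel] at h1 h2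
      have hne : -a * p ^ (-(k : ℤ) - 1) ≠ 0 := mul_ne_zero ha' (zpow_ne_zero _ hp0)
      apply mul_left_cancel₀ hne
      rw [← h1, ih, h2, zpow_add₀ hp0, zpow_sub_one₀ ha']
      field_simp
  refine ⟨D 0, fun x hpx hx => ?_⟩
  have hx0 : x ≠ 0 := norm_pos_iff.mp ((norm_nonneg _).trans_lt hpx)
  have hS := summable_bilateral ha hp0 hp hpx hx
  have hJx := summable_J hp0 hp (neg_ne_zero.mpr hx0)
  have hprod := summable_mul_of_summable_norm hJx.norm hS.norm
  rw [J, tsum_mul_tsum_of_summable_norm hJx.norm hS.norm]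
  -- Reindexing by (k, m) ↦ (m, k − m) collects the coefficient of x^k.
  let e : ℤ × ℤ ≃ ℤ × ℤ :=
    { toFun := fun t => (t.2, t.1 - t.2)
      invFun := fun t => (t.1 + t.2, t.1)
      left_inv := fun t => by simp
      right_inv := fun t => by simp }
  rw [← e.tsum_eq]
  refine (e.summable_iff.mpr hprod).tsum_prod.trans ?_
  rw [J, ← tsum_mul_left]
  refine tsum_congr fun k => ?_
  simp only [Function.comp]
  have : ∀ m : ℤ, p ^ ((e (k, m)).1 * ((e (k, m)).1 - 1) / 2) * (-x) ^ (e (k, m)).1 *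
      (x ^ (e (k, m)).2 / (1 - a * p ^ (e (k, m)).2)) =
      x ^ k * (p ^ (m * (m - 1) / 2) * (-1) ^ m * (1 - a * p ^ (k - m))⁻¹) := by
    intro m
    simp only [e, Equiv.coe_fn_mk]
    rw [neg_eq_neg_one_mul x, mul_zpow, zpow_sub₀ hx0]
    have := zpow_ne_zero m hx0
    field_simp
  simp only [this]
  rw [tsum_mul_left]
  change x ^ k * D k = _
  rw [hDk, mul_zpow]
  ring

theorem continuousAt_J {p z : ℂ} (hp0 : p ≠ 0) (hp : ‖p‖ < 1) (hz : z ≠ 0) :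
    ContinuousAt (J p) z := by
  have h : ContinuousAt (fun z => E p * qPoch (-z) p * qPoch (-p / z) p) z := by
    have hc := continuous_qPoch hp
    refine ContinuousAt.mul (ContinuousAt.mul continuousAt_const ?_) ?_
    · exact (hc.comp continuous_neg).continuousAt
    · exact hc.continuousAt.comp (f := fun z => -p / z) (continuousAt_const.div continuousAt_id hz)
  refine h.congr ?_
  filter_upwards [isOpen_ne.mem_nhds hz] with w hw
  exact (jacobi_triple_product hp0 hp hw).symm

/-- Kronecker's formula for `∑ xⁿ / (1 - a pⁿ)`. -/
theorem bilateral_eq {a p x : ℂ} (ha : a ≠ 0) (hp0 : p ≠ 0) (hp : ‖p‖ < 1)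
    (hap : ∀ n : ℤ, 1 - a * p ^ n ≠ 0) (hpx : ‖p‖ < ‖x‖) (hx : ‖x‖ < 1) :
    J p (-a) * J p (-x) * ∑' n : ℤ, x ^ n / (1 - a * p ^ n) = E p ^ 3 * J p (-a * x) := by
  obtain ⟨d, hd⟩ := exists_J_mul_bilateral ha hp0 hp hap
  -- The constant is found by letting x = t tend to 1 from below along the reals: J(p, −t) contains
  -- the factor 1 − t, which cancels the simple pole of the bilateral series.
  suffices h : d * J p (-a) = E p ^ 3 by
    rw [mul_assoc, hd x hpx hx, ← h]
    ring
  obtain ⟨r, hr1, hr2⟩ := exists_between hp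
  have hr0 : 0 < r := (norm_nonneg _).trans_lt hr1
  set e : ℤ → ℂ := fun n => (1 - a * p ^ n)⁻¹ - if 0 ≤ n then 1 else 0 with he
  have hes : ∀ t : ℝ, r ≤ t → t ≤ 1 → Summable fun n : ℤ => (t : ℂ) ^ n * e n := by
    intro t h1 h2
    have ht : ‖(t : ℂ)‖ = t := by rw [Complex.norm_real, Real.norm_of_nonneg (hr0.le.trans h1)]
    exact summable_bilateral_sub ha hp0 hp hap (by rw [ht]; linarith) (by rw [ht]; linarith)
  have hI : Set.Ioo r 1 ∈ 𝓝[<] (1 : ℝ) := Ioo_mem_nhdsLT hr2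
  have hcast : Tendsto (fun t : ℝ => (t : ℂ)) (𝓝[<] 1) (𝓝 1) :=
    (Complex.continuous_ofReal.tendsto' 1 1 Complex.ofReal_one).mono_left nhdsWithin_le_nhds
  -- `(1 - t) S(t) → 1`
  have hlim : Tendsto (fun t : ℝ => (1 - (t : ℂ)) * ∑' n : ℤ, (t : ℂ) ^ n / (1 - a * p ^ n))
      (𝓝[<] 1) (𝓝 1) := by
    have hT : Tendsto (fun t : ℝ => 1 + (1 - (t : ℂ)) * ∑' n : ℤ, (t : ℂ) ^ n * e n) (𝓝[<] 1)
        (𝓝 (1 + (1 - 1) * ∑' n : ℤ, (1 : ℂ) ^ n * e n)) := by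
      refine Tendsto.const_add _ ((hcast.const_sub 1).mul ?_)
      refine tendsto_tsum_of_dominated_convergence
        -- For r ≤ t ≤ 1, tⁿ is at most 1 when n ≥ 0 and at most rⁿ when n < 0.
        (bound := fun n : ℤ => ‖((1 : ℝ) : ℂ) ^ n * e n‖ + ‖(r : ℂ) ^ n * e n‖)
        ((hes 1 hr2.le le_rfl).norm.add (hes r le_rfl hr2.le).norm) (fun n => ?_) ?_
      · exact (((continuousAt_zpow₀ (1 : ℂ) n (Or.inl one_ne_zero)).tendsto).comp hcast).mul_const _
      · filter_upwards [hI] with t ht n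
        rw [norm_mul, norm_mul, norm_mul, ← add_mul, norm_zpow, norm_zpow, norm_zpow,
          Complex.norm_real, Complex.norm_real, Complex.norm_real,
          Real.norm_of_nonneg (hr0.le.trans ht.1.le), Real.norm_of_nonneg hr0.le, norm_one,
          one_zpow]
        gcongr
        rcases le_or_gt 0 n with hn | hn
        · lift n to ℕ using hn
          have := pow_le_one₀ (n := n) (hr0.le.trans ht.1.le) ht.2.le
          rw [zpow_natCast, zpow_natCast]
          have := pow_pos hr0 n
          linarith
        · obtain ⟨k, rfl⟩ : ∃ k : ℕ, n = -(k : ℤ) := ⟨n.natAbs, by omega⟩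
          rw [zpow_neg, zpow_neg, zpow_natCast, zpow_natCast]
          have : (t ^ k)⁻¹ ≤ (r ^ k)⁻¹ := by gcongr; exact ht.1.le
          linarith
    simp only [sub_self, zero_mul, add_zero] at hT
    refine hT.congr' ?_
    filter_upwards [hI] with t ht
    have htn : ‖(t : ℂ)‖ = t := by rw [Complex.norm_real, Real.norm_of_nonneg (hr0.le.trans ht.1.le)]
    have ht1 : ‖(t : ℂ)‖ < 1 := by rw [htn]; exact ht.2
    have hg : HasSum (fun n : ℤ => (t : ℂ) ^ n * if 0 ≤ n then 1 else 0) (1 - (t : ℂ))⁻¹ := by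
      have h1 := hasSum_geometric_of_norm_lt_one ht1
      have h2 : HasSum (fun n : ℕ => (t : ℂ) ^ (-((n : ℤ) + 1)) *
          if 0 ≤ (-((n : ℤ) + 1)) then 1 else 0) 0 := by
        convert hasSum_zero with n
        rw [if_neg (by omega), mul_zero]
      have := HasSum.of_nat_of_neg_add_one (f := fun n : ℤ => (t : ℂ) ^ n * if 0 ≤ n then 1 else 0)
        (by simpa using h1) h2
      simpa using this
    have hsum := ((hes t ht.1.le ht.2.le).hasSum.add hg).tsum_eq
    have e1 : ∑' n : ℤ, (t : ℂ) ^ n / (1 - a * p ^ n) =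
        ∑' n : ℤ, (t : ℂ) ^ n * e n + (1 - (t : ℂ))⁻¹ := by
      rw [← hsum]
      refine tsum_congr fun n => ?_
      rw [he, div_eq_mul_inv]
      ring
    have hne : (1 - (t : ℂ)) ≠ 0 := sub_ne_zero.mpr fun h => by
      rw [← h, norm_one] at ht1; exact lt_irrefl _ ht1
    rw [e1, mul_add, mul_inv_cancel₀ hne, add_comm]
  have hc := continuous_qPoch hp
  have hL : Tendsto (fun t : ℝ => E p * qPoch (t * p) p * qPoch (p / t) p *
      ((1 - (t : ℂ)) * ∑' n : ℤ, (t : ℂ) ^ n / (1 - a * p ^ n))) (𝓝[<] 1)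
      (𝓝 (E p * qPoch (1 * p) p * qPoch (p / 1) p * 1)) := by
    refine Tendsto.mul (Tendsto.mul (Tendsto.mul tendsto_const_nhds ?_) ?_) hlim
    · exact (hc.tendsto _).comp (hcast.mul_const p)
    · exact (hc.tendsto _).comp (tendsto_const_nhds.div hcast one_ne_zero)
  have hR : Tendsto (fun t : ℝ => d * J p (-a * t)) (𝓝[<] 1) (𝓝 (d * J p (-a * 1))) :=
    ((continuousAt_J hp0 hp (by simpa using ha)).tendsto.comp (hcast.const_mul (-a))).const_mul d
  rw [mul_one] at hR
  refine tendsto_nhds_unique hR ?_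
  have hval : E p * qPoch (1 * p) p * qPoch (p / 1) p * 1 = E p ^ 3 := by
    rw [one_mul, div_one, mul_one]
    change E p * E p * E p = _
    ring
  rw [← hval]
  refine hL.congr' ?_
  filter_upwards [hI] with t ht
  have htn : ‖(t : ℂ)‖ = t := by rw [Complex.norm_real, Real.norm_of_nonneg (hr0.le.trans ht.1.le)]
  have ht0 : (t : ℂ) ≠ 0 := by
    rw [Ne, Complex.ofReal_eq_zero]; exact (hr0.trans ht.1).ne'
  rw [← hd t (by rw [htn]; exact hr1.trans ht.1) (by rw [htn]; exact ht.2),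
    jacobi_triple_product hp0 hp (neg_ne_zero.mpr ht0), neg_neg, neg_div_neg_eq,
    qPoch_eq_mul (t : ℂ) hp]
  ring

/-! ### Eta quotients -/

theorem norm_pow_lt_one {q : ℂ} (hq : ‖q‖ < 1) {k : ℕ} (hk : k ≠ 0) : ‖q ^ k‖ < 1 := by
  rw [norm_pow]; exact pow_lt_one₀ (norm_nonneg _) hq hk

theorem E_pow_ne_zero {q : ℂ} (hq : ‖q‖ < 1) {k : ℕ} (hk : k ≠ 0) : E (q ^ k) ≠ 0 :=
  E_ne_zero (norm_pow_lt_one hq hk)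

theorem qPoch_neg_self {q : ℂ} (hq : ‖q‖ < 1) : qPoch (-q) q = E (q ^ 2) / E q := by
  rw [eq_div_iff (E_ne_zero hq), mul_comm]
  exact qPoch_mul_qPoch_neg q hq

theorem qPoch_self_sq {q : ℂ} (hq : ‖q‖ < 1) : qPoch q (q ^ 2) = E q / E (q ^ 2) := by
  rw [eq_div_iff (E_pow_ne_zero hq two_ne_zero), E, E, qPoch_split_two q hq, ← sq]

theorem qPoch_neg_self_sq {q : ℂ} (hq : ‖q‖ < 1) :
    qPoch (-q) (q ^ 2) = E (q ^ 2) ^ 2 / (E q * E (q ^ 4)) := by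
  have h1 := qPoch_mul_qPoch_neg q (norm_pow_lt_one hq two_ne_zero)
  rw [qPoch_self_sq hq, qPoch_self_sq (norm_pow_lt_one hq two_ne_zero)] at h1
  have e1 := E_ne_zero hq
  have e2 := E_pow_ne_zero hq two_ne_zero
  rw [← pow_mul, show 2 * 2 = 4 from rfl] at h1
  have e4 := E_pow_ne_zero hq four_ne_zero
  field_simp at h1 ⊢
  linear_combination h1

/-- Changing the sign of q affects only the odd powers in the product. This lets every theta
identity be used at −q as well. -/
theorem E_neg {q : ℂ} (hq : ‖q‖ < 1) : E (-q) = E (q ^ 2) ^ 3 / (E q * E (q ^ 4)) := by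
  have h := qPoch_split_two (-q) (q := -q) (by rwa [norm_neg])
  rw [neg_mul_neg, neg_sq, qPoch_neg_self_sq hq, ← sq] at h
  rw [E, h, E]
  ring

theorem J_one {q : ℂ} (hq0 : q ≠ 0) (hq : ‖q‖ < 1) : J q 1 = 2 * E (q ^ 2) ^ 2 / E q := by
  rw [jacobi_triple_product hq0 hq one_ne_zero, qPoch_eq_mul _ hq, div_one, neg_one_mul,
    qPoch_neg_self hq]
  have e1 := E_ne_zero hq
  field_simp
  ring

theorem phi_eq_J {q : ℂ} (hq0 : q ≠ 0) : phi q = J (q ^ 2) q := by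
  refine tsum_congr fun n => ?_
  rw [← zpow_natCast q 2, ← zpow_mul, ← zpow_add₀ hq0, ← zpow_add₀ hq0]
  congr 1
  have h1 := two_mul_tri n
  have h2 := tri_succ n
  rw [add_sub_cancel_right, mul_comm] at h2
  push_cast
  linarith

theorem phi_eq_E {q : ℂ} (hq0 : q ≠ 0) (hq : ‖q‖ < 1) :
    phi q = E (q ^ 2) ^ 5 / (E q ^ 2 * E (q ^ 4) ^ 2) := by
  rw [phi_eq_J hq0, jacobi_triple_product (pow_ne_zero 2 hq0) (norm_pow_lt_one hq two_ne_zero) hq0,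
    show -q ^ 2 / q = -q by field_simp, qPoch_neg_self_sq hq]
  have e1 := E_ne_zero hq
  have e4 := E_pow_ne_zero hq four_ne_zero
  field_simp

theorem phi_neg {q : ℂ} (hq0 : q ≠ 0) (hq : ‖q‖ < 1) : phi (-q) = E q ^ 2 / E (q ^ 2) := by
  rw [phi_eq_E (neg_ne_zero.mpr hq0) (by rwa [norm_neg]), E_neg hq, neg_sq,
    Even.neg_pow (by decide)]
  have e1 := E_ne_zero hq
  have e2 := E_pow_ne_zero hq two_ne_zero
  have e4 := E_pow_ne_zero hq four_ne_zero
  field_simp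

theorem J_neg_one_neg {q : ℂ} (hq0 : q ≠ 0) (hq : ‖q‖ < 1) :
    J (-q) 1 = 2 * (E q * E (q ^ 4)) / E (q ^ 2) := by
  rw [J_one (neg_ne_zero.mpr hq0) (by rwa [norm_neg]), E_neg hq, neg_sq]
  have e1 := E_ne_zero hq
  have e2 := E_pow_ne_zero hq two_ne_zero
  have e4 := E_pow_ne_zero hq four_ne_zero
  field_simp

theorem J_four {q : ℂ} (hq0 : q ≠ 0) (hq : ‖q‖ < 1) :
    J (q ^ 4) (-q) = E (q ^ 4) * E q / E (q ^ 2) := by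
  have h2 := norm_pow_lt_one hq two_ne_zero
  have h := qPoch_split_two q h2
  rw [qPoch_self_sq hq, ← pow_mul, ← pow_succ'] at h
  rw [jacobi_triple_product (pow_ne_zero 4 hq0) (norm_pow_lt_one hq four_ne_zero)
    (neg_ne_zero.mpr hq0), neg_neg, neg_div_neg_eq, show q ^ 4 / q = q ^ 3 by field_simp,
    mul_assoc, mul_div_assoc, h]

/-- Euler's pentagonal number theorem: the exponents 1, 2, 3 modulo 3 together give all of E(q). -/
theorem J_three {q : ℂ} (hq0 : q ≠ 0) (hq : ‖q‖ < 1) : J (q ^ 3) (-q) = E q := by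
  have h : E q = _ := qPoch_split_three q hq
  rw [jacobi_triple_product (pow_ne_zero 3 hq0) (norm_pow_lt_one hq three_ne_zero)
    (neg_ne_zero.mpr hq0), neg_neg, neg_div_neg_eq, show q ^ 3 / q = q ^ 2 by field_simp, h, E,
    ← pow_succ', ← sq]
  ring

theorem J_three_pos {q : ℂ} (hq0 : q ≠ 0) (hq : ‖q‖ < 1) :
    J (q ^ 3) q = E (q ^ 2) * E (q ^ 3) ^ 2 / (E q * E (q ^ 6)) := by
  have h3 := norm_pow_lt_one hq three_ne_zero
  have h := qPoch_split_three (-q) hq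
  have h' := qPoch_neg_self h3
  rw [qPoch_neg_self hq, neg_mul, neg_mul, ← sq, ← pow_succ', h', ← pow_mul,
    show 3 * 2 = 6 from rfl] at h
  rw [jacobi_triple_product (pow_ne_zero 3 hq0) h3 hq0,
    show -q ^ 3 / q = -q ^ 2 by field_simp]
  have e1 := E_ne_zero hq
  have e3 := E_ne_zero h3
  have e6 := E_pow_ne_zero hq (k := 6) (by norm_num)
  field_simp at h ⊢
  linear_combination -h

/-- The factors other than E(q¹²)² run over the exponents 1, 5, 7, 11 modulo 12, that is, over the
odd exponents with the multiples of 3 removed. -/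
theorem J_twelve_mul {q : ℂ} (hq0 : q ≠ 0) (hq : ‖q‖ < 1) :
    J (q ^ 12) (-q) * J (q ^ 12) (-q ^ 5) =
      E (q ^ 12) ^ 2 * E q * E (q ^ 6) / (E (q ^ 2) * E (q ^ 3)) := by
  have n2 := norm_pow_lt_one hq two_ne_zero
  have n6 := norm_pow_lt_one hq (k := 6) (by norm_num)
  have n12 := norm_pow_lt_one hq (k := 12) (by norm_num)
  have h1 := qPoch_split_three q n2
  have h3 := qPoch_self_sq (norm_pow_lt_one hq three_ne_zero)
  have h4 := qPoch_split_two q n6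
  have h5 := qPoch_split_two (q ^ 5) n6
  simp only [← pow_mul, ← pow_succ', ← pow_add, Nat.reduceMul, Nat.reduceAdd] at h1 h3 h4 h5
  rw [qPoch_self_sq hq, h3, h4, h5] at h1
  rw [jacobi_triple_product (pow_ne_zero 12 hq0) n12 (neg_ne_zero.mpr hq0),
    jacobi_triple_product (pow_ne_zero 12 hq0) n12 (neg_ne_zero.mpr (pow_ne_zero 5 hq0)),
    neg_neg, neg_div_neg_eq, neg_neg, neg_div_neg_eq, show q ^ 12 / q = q ^ 11 by field_simp,
    show q ^ 12 / q ^ 5 = q ^ 7 by field_simp]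
  have e2 := E_ne_zero n2
  have e3 := E_pow_ne_zero hq three_ne_zero
  have e6 := E_ne_zero n6
  field_simp at h1 ⊢
  linear_combination -E (q ^ 12) ^ 2 * h1

/-! ### Rearranging theta series -/

theorem tsum_eq_add_of_bijective {α β γ : Type*} {f : γ → ℂ} (hf : Summable f) (u : α → γ)
    (v : β → γ) (h : Function.Bijective (Sum.elim u v)) :
    ∑' c, f c = ∑' a, f (u a) + ∑' b, f (v b) := by
  have hu : Function.Injective u := fun a b hab => Sum.inl_injective (h.1 hab)
  have hv : Function.Injective v := fun a b hab => Sum.inr_injective (h.1 hab)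
  have h1 := hf.comp_injective hu
  have h2 := hf.comp_injective hv
  rw [← (Equiv.ofBijective _ h).tsum_eq]
  exact Summable.tsum_sum (f := fun c => f (Sum.elim u v c)) h1 h2

theorem J_mul_J {q r z w : ℂ} (hq0 : q ≠ 0) (hq : ‖q‖ < 1) (hr0 : r ≠ 0) (hr : ‖r‖ < 1)
    (hz : z ≠ 0) (hw : w ≠ 0) :
    HasSum (fun t : ℤ × ℤ => q ^ (t.1 * (t.1 - 1) / 2) * z ^ t.1 *
      (r ^ (t.2 * (t.2 - 1) / 2) * w ^ t.2)) (J q z * J r w) := by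
  have h1 := summable_J hq0 hq hz
  have h2 := summable_J hr0 hr hw
  rw [J, J, tsum_mul_tsum_of_summable_norm h1.norm h2.norm]
  exact (summable_mul_of_summable_norm h1.norm h2.norm).hasSum

theorem phi_eq_add {q : ℂ} (hq0 : q ≠ 0) (hq : ‖q‖ < 1) :
    phi q = phi (q ^ 4) + q * J (q ^ 8) 1 := by
  have hb : Function.Bijective (Sum.elim (fun k : ℤ => 2 * k) fun k : ℤ => 2 * k - 1) := by
    constructor
    · rintro (a | a) (b | b) h <;> simp at h ⊢ <;> omega
    · intro n
      rcases Int.even_or_odd' n with ⟨k, rfl | rfl⟩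
      · exact ⟨Sum.inl k, rfl⟩
      · exact ⟨Sum.inr (k + 1), by simp; ring⟩
  rw [phi_eq_J hq0, J, tsum_eq_add_of_bijective (summable_J (pow_ne_zero 2 hq0)
    (norm_pow_lt_one hq two_ne_zero) hq0) _ _ hb, phi_eq_J (pow_ne_zero 4 hq0), J, J,
    ← tsum_mul_left]
  congr 1
  · refine tsum_congr fun k => ?_
    simp only [← zpow_natCast, ← zpow_mul, ← zpow_add₀ hq0]
    congr 1
    have h1 := two_mul_tri k
    have h2 := two_mul_tri (2 * k)
    push_cast
    linarith
  · refine tsum_congr fun k => ?_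
    simp only [one_zpow, mul_one, ← zpow_natCast, ← zpow_mul, ← zpow_add₀ hq0,
      ← zpow_one_add₀ hq0]
    congr 1
    have h1 := two_mul_tri k
    have h2 := two_mul_tri (2 * k - 1)
    push_cast
    linarith

theorem bijective_lattice_even_odd : Function.Bijective (Sum.elim
    (fun t : ℤ × ℤ => (t.1 + t.2, t.1 - t.2)) fun t : ℤ × ℤ => (t.1 + t.2 - 1, t.1 - t.2)) := by
  constructor
  · rintro (⟨a, b⟩ | ⟨a, b⟩) (⟨c, d⟩ | ⟨c, d⟩) h <;> simp at h ⊢ <;> omega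
  · rintro ⟨m, n⟩
    rcases Int.even_or_odd' (m + n) with ⟨k, h | h⟩
    · exact ⟨Sum.inl (k, m - k), by simp; omega⟩
    · exact ⟨Sum.inr (k + 1, m - k), by simp; omega⟩

/-- The odd coset is parametrised through n ↦ 1 − n, which fixes n(n − 1)/2; for products of series
J(·, 1) both halves are then equal. -/
theorem bijective_lattice_reflect : Function.Bijective (Sum.elim
    (fun t : ℤ × ℤ => (t.1 + t.2, t.1 - t.2)) fun t : ℤ × ℤ => (t.1 + t.2, 1 - (t.1 - t.2))) := by
  constructor
  · rintro (⟨a, b⟩ | ⟨a, b⟩) (⟨c, d⟩ | ⟨c, d⟩) h <;> simp at h ⊢ <;> omega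
  · rintro ⟨m, n⟩
    rcases Int.even_or_odd' (m + n) with ⟨k, h | h⟩
    · exact ⟨Sum.inl (k, m - k), by simp; omega⟩
    · exact ⟨Sum.inr (m - k, k), by simp; omega⟩

/-- Composed with (m, n) ↦ (m + n, m − n), the even case becomes (r + 3s, r − s), which diagonalises
x² + 3y² as 4r² + 12s². -/
theorem bijective_lattice_shear : Function.Bijective (Sum.elim
    (fun t : ℤ × ℤ => (t.1 + t.2, 2 * t.2)) fun t : ℤ × ℤ => (t.1 + t.2, 2 * t.2 - 1)) := by
  constructor
  · rintro (⟨a, b⟩ | ⟨a, b⟩) (⟨c, d⟩ | ⟨c, d⟩) h <;> simp at h ⊢ <;> omega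
  · rintro ⟨m, n⟩
    rcases Int.even_or_odd' n with ⟨k, h | h⟩
    · exact ⟨Sum.inl (m - k, k), by simp; omega⟩
    · exact ⟨Sum.inr (m - k - 1, k + 1), by simp; omega⟩

theorem phi_sq {q : ℂ} (hq0 : q ≠ 0) (hq : ‖q‖ < 1) :
    phi q ^ 2 = phi (q ^ 2) ^ 2 + q * J (q ^ 4) 1 ^ 2 := by
  have n2 := norm_pow_lt_one hq two_ne_zero
  have n4 := norm_pow_lt_one hq four_ne_zero
  have z2 := pow_ne_zero 2 hq0
  have z4 := pow_ne_zero 4 hq0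
  have h := J_mul_J z2 n2 z2 n2 hq0 hq0
  have h4 := J_mul_J z4 n4 z4 n4 z2 z2
  have h5 := J_mul_J z4 n4 z4 n4 one_ne_zero one_ne_zero
  have z22 : (q ^ 2) ^ 2 = q ^ 4 := by ring
  rw [phi_eq_J hq0, phi_eq_J z2, z22, sq (J _ _), sq (J _ _), sq (J _ _), ← h.tsum_eq,
    tsum_eq_add_of_bijective h.summable _ _ bijective_lattice_even_odd, ← h4.tsum_eq,
    ← h5.tsum_eq, ← tsum_mul_left]
  congr 1 <;> refine tsum_congr fun ⟨r, s⟩ => ?_ <;>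
  · simp only [one_zpow, mul_one, ← zpow_natCast, ← zpow_mul, ← zpow_add₀ hq0,
      ← zpow_one_add₀ hq0]
    congr 1
    have h1 := two_mul_tri r
    have h2 := two_mul_tri s
    have h3 := two_mul_tri (r + s)
    have h4 := two_mul_tri (r - s)
    have h5 := two_mul_tri (r + s - 1)
    push_cast
    linarith

theorem J_one_mul_J_one {q : ℂ} (hq0 : q ≠ 0) (hq : ‖q‖ < 1) :
    J q 1 * J (q ^ 3) 1 =
      2 * J (q ^ 4) 1 * phi (q ^ 6) + 2 * q * phi (q ^ 2) * J (q ^ 12) 1 := by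
  have n3 := norm_pow_lt_one hq three_ne_zero
  have n4 := norm_pow_lt_one hq four_ne_zero
  have n12 := norm_pow_lt_one hq (k := 12) (by norm_num)
  have z2 := pow_ne_zero 2 hq0
  have z3 := pow_ne_zero 3 hq0
  have z4 := pow_ne_zero 4 hq0
  have z6 := pow_ne_zero 6 hq0
  have z12 := pow_ne_zero 12 hq0
  have h := J_mul_J hq0 hq z3 n3 one_ne_zero one_ne_zero
  have h4 := J_mul_J z4 n4 z12 n12 one_ne_zero z6
  have h5 := J_mul_J z4 n4 z12 n12 z2 one_ne_zero
  have e1 : ∀ t : ℤ × ℤ, q ^ ((t.1 + t.2) * (t.1 + t.2 - 1) / 2) * 1 ^ (t.1 + t.2) *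
      ((q ^ 3) ^ ((1 - (t.1 - t.2)) * (1 - (t.1 - t.2) - 1) / 2) * 1 ^ (1 - (t.1 - t.2))) =
      q ^ ((t.1 + t.2) * (t.1 + t.2 - 1) / 2) * 1 ^ (t.1 + t.2) *
      ((q ^ 3) ^ ((t.1 - t.2) * (t.1 - t.2 - 1) / 2) * 1 ^ (t.1 - t.2)) := fun t => by
    rw [one_zpow, one_zpow, one_zpow]
    congr 4
    ring
  have hs := h.summable.comp_injective (i := fun t : ℤ × ℤ => (t.1 + t.2, t.1 - t.2)) (by
    rintro ⟨a, b⟩ ⟨c, d⟩ h; simp at h ⊢; omega)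
  simp only [Function.comp_def] at hs
  have z22 : (q ^ 2) ^ 2 = q ^ 4 := by ring
  have z62 : (q ^ 6) ^ 2 = q ^ 12 := by ring
  rw [phi_eq_J z2, phi_eq_J z6, z22, z62, mul_assoc 2, mul_assoc 2, mul_assoc 2, mul_assoc q,
    ← h.tsum_eq, tsum_eq_add_of_bijective h.summable _ _ bijective_lattice_reflect, ← h4.tsum_eq,
    ← h5.tsum_eq, ← tsum_mul_left (a := q)]
  simp only [e1]
  rw [← two_mul, ← mul_add, tsum_eq_add_of_bijective hs _ _ bijective_lattice_shear]
  congr 2 <;> refine tsum_congr fun ⟨r, s⟩ => ?_ <;>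
  · simp only [one_zpow, mul_one, ← zpow_natCast, ← zpow_mul, ← zpow_add₀ hq0,
      ← zpow_one_add₀ hq0]
    congr 1
    have h1 := two_mul_tri r
    have h2 := two_mul_tri s
    have h3 := two_mul_tri (r + s + 2 * s)
    have h4 := two_mul_tri (r + s - 2 * s)
    have h5 := two_mul_tri (r + s + (2 * s - 1))
    have h6 := two_mul_tri (r + s - (2 * s - 1))
    push_cast
    linarith

/-- The two products carry the signs (−1)ⁿ and (−1)ᵐ. Terms with m + n odd cancel, those with m + n
even double, and m = r + s, n = r − s separates the rest. -/
theorem J_mul_J_add {q : ℂ} (hq0 : q ≠ 0) (hq : ‖q‖ < 1) :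
    J (q ^ 12) q * J (q ^ 12) (-q ^ 5) + J (q ^ 12) (-q) * J (q ^ 12) (q ^ 5) =
      2 * (J (q ^ 24) (-q ^ 6) * J (q ^ 24) (-q ^ 8)) := by
  have n12 := norm_pow_lt_one hq (k := 12) (by norm_num)
  have n24 := norm_pow_lt_one hq (k := 24) (by norm_num)
  have z12 := pow_ne_zero 12 hq0
  have z24 := pow_ne_zero 24 hq0
  have z5 := pow_ne_zero 5 hq0
  have h1 := J_mul_J z12 n12 z12 n12 hq0 (neg_ne_zero.mpr z5)
  have h2 := J_mul_J z12 n12 z12 n12 (neg_ne_zero.mpr hq0) z5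
  have h := h1.add h2
  have h3 := J_mul_J z24 n24 z24 n24 (neg_ne_zero.mpr (pow_ne_zero 6 hq0))
    (neg_ne_zero.mpr (pow_ne_zero 8 hq0))
  have hm : (-1 : ℂ) ≠ 0 := by simp
  have hinv : ∀ n : ℤ, ((-1 : ℂ) ^ n)⁻¹ = (-1) ^ n := fun n => by
    rw [← inv_zpow, inv_neg, inv_one]
  rw [← h.tsum_eq, tsum_eq_add_of_bijective h.summable _ _ bijective_lattice_even_odd,
    ← h3.tsum_eq, ← tsum_mul_left]
  simp only [neg_eq_neg_one_mul q, neg_eq_neg_one_mul (q ^ 5), neg_eq_neg_one_mul (q ^ 6),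
    neg_eq_neg_one_mul (q ^ 8), mul_zpow, zpow_sub₀ hm, zpow_add₀ hm, zpow_one, div_eq_mul_inv,
    hinv, inv_neg, inv_one]
  rw [← add_zero (∑' b : ℤ × ℤ, 2 * _)]
  congr 1
  · refine tsum_congr fun ⟨r, s⟩ => ?_
    have e : ∀ A B C D A' B' C' D' u v : ℂ, A * B * (C * D) = A' * B' * (C' * D') →
        A * B * (C * (u * v * D)) + A * (u * v * B) * (C * D) =
          2 * (A' * (u * B') * (C' * (v * D'))) := fun A B C D A' B' C' D' u v h => by
      linear_combination 2 * u * v * h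
    apply e
    simp only [← zpow_natCast, ← zpow_mul, ← zpow_add₀ hq0]
    congr 1
    have h1 := two_mul_tri r
    have h2 := two_mul_tri s
    have h3 := two_mul_tri (r + s)
    have h4 := two_mul_tri (r - s)
    push_cast
    linarith
  · rw [← tsum_zero (β := ℤ × ℤ)]
    refine tsum_congr fun ⟨r, s⟩ => ?_
    ring

/-- This is the pentagonal series split by the parity of its index. -/
theorem J_twelve_sub {q : ℂ} (hq0 : q ≠ 0) (hq : ‖q‖ < 1) :
    J (q ^ 12) (q ^ 7) - q * J (q ^ 12) q = E q := by
  have n3 := norm_pow_lt_one hq three_ne_zero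
  have hb : Function.Bijective (Sum.elim (fun k : ℤ => -2 * k) fun k : ℤ => 1 - 2 * k) := by
    constructor
    · rintro (a | a) (b | b) h <;> simp at h ⊢ <;> omega
    · intro n
      rcases Int.even_or_odd' n with ⟨k, rfl | rfl⟩
      · exact ⟨Sum.inl (-k), by simp⟩
      · exact ⟨Sum.inr (-k), by simp; ring⟩
  have hm : (-1 : ℂ) ≠ 0 := by simp
  rw [← J_three hq0 hq, J, J, J, tsum_eq_add_of_bijective (summable_J (pow_ne_zero 3 hq0) n3
    (neg_ne_zero.mpr hq0)) _ _ hb, sub_eq_add_neg, ← neg_mul, ← tsum_mul_left]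
  simp only [neg_eq_neg_one_mul q, mul_zpow, zpow_sub₀ hm, zpow_mul (-1 : ℂ)]
  congr 1
  · refine tsum_congr fun k => ?_
    have e : ((-1 : ℂ) ^ (-2 : ℤ)) ^ k = 1 := by norm_num
    rw [e, one_mul]
    simp only [← zpow_natCast, ← zpow_mul, ← zpow_add₀ hq0]
    congr 1
    have h1 := two_mul_tri k
    have h2 := two_mul_tri (-2 * k)
    push_cast
    linarith
  · refine tsum_congr fun k => ?_
    have e : (-1 : ℂ) ^ (1 : ℤ) / ((-1 : ℂ) ^ (2 : ℤ)) ^ k = -1 := by norm_num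
    rw [e, mul_assoc (-1), mul_left_comm _ (-1 : ℂ)]
    congr 1
    simp only [← zpow_natCast, ← zpow_mul, ← zpow_add₀ hq0, ← zpow_one_add₀ hq0]
    congr 1
    have h1 := two_mul_tri k
    have h2 := two_mul_tri (1 - 2 * k)
    push_cast
    linarith

theorem J_mul_base {q z : ℂ} (hq0 : q ≠ 0) (hz : z ≠ 0) : z * J q (q * z) = J q z := by
  rw [J, J, ← (Equiv.addRight (1 : ℤ)).tsum_eq (fun n : ℤ => q ^ (n * (n - 1) / 2) * z ^ n),
    ← tsum_mul_left]
  refine tsum_congr fun n => ?_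
  rw [Equiv.coe_addRight, tri_succ, mul_zpow, zpow_add₀ hq0, zpow_add_one₀ hz]
  ring

theorem J_div {q z : ℂ} (hq0 : q ≠ 0) : J q (q / z) = J q z := by
  rw [J, J, ← (Equiv.neg ℤ).tsum_eq (fun n : ℤ => q ^ (n * (n - 1) / 2) * z ^ n)]
  refine tsum_congr fun n => ?_
  have h1 := two_mul_tri n
  have h2 := two_mul_tri (-n)
  rw [Equiv.neg_apply, div_zpow, show -n * (-n - 1) / 2 = n * (n - 1) / 2 + n by linarith,
    zpow_add₀ hq0, zpow_neg]
  ring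

/-! ### Values at the origin and analyticity in the unit disc. -/

theorem E_zero : E 0 = 1 := by simp [E, qPoch]

theorem phi_zero : phi 0 = 1 := by
  rw [phi_eq_tsum, tsum_eq_single 0]
  · simp
  · intro n hn
    simp [hn]

theorem phi_eq_E_of_norm_lt_one {q : ℂ} (hq : ‖q‖ < 1) :
    phi q = E (q ^ 2) ^ 5 / (E q ^ 2 * E (q ^ 4) ^ 2) := by
  rcases eq_or_ne q 0 with rfl | hq0
  · simp [phi_zero, E_zero]
  · exact phi_eq_E hq0 hq

theorem differentiableOn_E : DifferentiableOn ℂ E (Metric.ball 0 1) := by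
  refine ModularForm.differentiableOn_tprod_one_sub_pow.congr fun q _ => ?_
  simp only [E, qPoch, pow_succ']

theorem differentiableOn_E_pow {k : ℕ} (hk : k ≠ 0) :
    DifferentiableOn ℂ (fun q => E (q ^ k)) (Metric.ball 0 1) := by
  refine differentiableOn_E.comp (by fun_prop) fun q hq => ?_
  rw [mem_ball_zero_iff] at hq ⊢
  exact norm_pow_lt_one hq hk

theorem differentiableOn_phi : DifferentiableOn ℂ phi (Metric.ball 0 1) := by
  have h1 := differentiableOn_E
  have h2 := differentiableOn_E_pow two_ne_zero
  have h4 := differentiableOn_E_pow four_ne_zero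
  refine ((h2.pow 5).div ((h1.pow 2).mul (h4.pow 2)) fun q hq => ?_).congr fun q hq => ?_
  · rw [mem_ball_zero_iff] at hq
    exact mul_ne_zero (pow_ne_zero _ (E_ne_zero hq)) (pow_ne_zero _ (E_pow_ne_zero hq four_ne_zero))
  · rw [mem_ball_zero_iff] at hq
    exact phi_eq_E_of_norm_lt_one hq

theorem differentiableOn_phi_pow {k : ℕ} (hk : k ≠ 0) :
    DifferentiableOn ℂ (fun q => phi (q ^ k)) (Metric.ball 0 1) := by
  refine differentiableOn_phi.comp (by fun_prop) fun q hq => ?_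
  rw [mem_ball_zero_iff] at hq ⊢
  exact norm_pow_lt_one hq hk

theorem differentiableOn_P : DifferentiableOn ℂ P (Metric.ball 0 1) := by
  refine ((((differentiableOn_E_pow two_ne_zero).mul (differentiableOn_E_pow three_ne_zero)).mul
    (differentiableOn_E_pow (k := 8) (by norm_num))).mul
    (differentiableOn_E_pow (k := 12) (by norm_num))).div
    (differentiableOn_E.mul (differentiableOn_E_pow (k := 24) (by norm_num))) fun q hq => ?_
  rw [mem_ball_zero_iff] at hq
  exact mul_ne_zero (E_ne_zero hq) (E_pow_ne_zero hq (by norm_num))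

theorem differentiableOn_Q : DifferentiableOn ℂ Q (Metric.ball 0 1) := by
  refine (differentiableOn_id.mul (((differentiableOn_E.mul
    (differentiableOn_E_pow four_ne_zero)).mul
    (differentiableOn_E_pow (k := 6) (by norm_num))).mul
    (differentiableOn_E_pow (k := 24) (by norm_num)))).div
    ((differentiableOn_E_pow three_ne_zero).mul
      (differentiableOn_E_pow (k := 8) (by norm_num))) fun q hq => ?_
  rw [mem_ball_zero_iff] at hq
  exact mul_ne_zero (E_pow_ne_zero hq three_ne_zero) (E_pow_ne_zero hq (by norm_num))

theorem P_zero : P 0 = 1 := by simp [P, E_zero]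

theorem Q_zero : Q 0 = 0 := by simp [Q]

/-! ### Quadratic relations between the theta products and P, Q. -/

theorem J_one_mul_J_one_neg {q : ℂ} (hq0 : q ≠ 0) (hq : ‖q‖ < 1) :
    J (-q) 1 * J (-q ^ 3) 1 =
      2 * J (q ^ 4) 1 * phi (q ^ 6) - 2 * q * phi (q ^ 2) * J (q ^ 12) 1 := by
  have h := J_one_mul_J_one (neg_ne_zero.mpr hq0) (show ‖-q‖ < 1 by rwa [norm_neg])
  rw [neg_sq, Odd.neg_pow (by decide : Odd 3), Even.neg_pow (by decide : Even 4),
    Even.neg_pow (by decide : Even 6), Even.neg_pow (by decide : Even 12)] at h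
  linear_combination h

theorem phi_neg_sq {q : ℂ} (hq0 : q ≠ 0) (hq : ‖q‖ < 1) :
    phi (-q) ^ 2 = phi (q ^ 2) ^ 2 - q * J (q ^ 4) 1 ^ 2 := by
  have h := phi_sq (neg_ne_zero.mpr hq0) (show ‖-q‖ < 1 by rwa [norm_neg])
  rw [neg_sq, Even.neg_pow (by decide : Even 4)] at h
  linear_combination h

theorem phi_neg_eq_sub {q : ℂ} (hq0 : q ≠ 0) (hq : ‖q‖ < 1) :
    phi (-q) = phi (q ^ 4) - q * J (q ^ 8) 1 := by
  have h := phi_eq_add (neg_ne_zero.mpr hq0) (show ‖-q‖ < 1 by rwa [norm_neg])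
  rw [Even.neg_pow (by decide : Even 4), Even.neg_pow (by decide : Even 8)] at h
  linear_combination h

/-- Dissecting φ(q)² and φ(q³)² leaves q times a difference of squares, whose two factors are half
of J(q, 1)J(q³, 1) and half of the same product at −q. -/
theorem phi_sq_sub_phi_sq {q : ℂ} (hq : ‖q‖ < 1) :
    (phi q * phi (q ^ 6)) ^ 2 - (phi (q ^ 2) * phi (q ^ 3)) ^ 2 = 4 * (P q * Q q) := by
  rcases eq_or_ne q 0 with rfl | hq0
  · simp [phi_zero, Q_zero]
  have n3 := norm_pow_lt_one hq three_ne_zero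
  have z3 := pow_ne_zero 3 hq0
  have h1 := phi_sq hq0 hq
  have h3 := phi_sq z3 n3
  have i1 := J_one_mul_J_one hq0 hq
  have i2 := J_one_mul_J_one_neg hq0 hq
  rw [J_one hq0 hq, J_one z3 n3] at i1
  rw [J_neg_one_neg hq0 hq, J_neg_one_neg z3 n3] at i2
  simp only [← pow_mul, Nat.reduceMul] at h3 i1 i2
  have e1 := E_ne_zero hq
  have e2 := E_pow_ne_zero hq (k := 2) (by norm_num)
  have e3 := E_pow_ne_zero hq (k := 3) (by norm_num)
  have e6 := E_pow_ne_zero hq (k := 6) (by norm_num)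
  have e8 := E_pow_ne_zero hq (k := 8) (by norm_num)
  have e24 := E_pow_ne_zero hq (k := 24) (by norm_num)
  have hPQ : P q * Q q = q * (E (q ^ 2) * E (q ^ 4) * E (q ^ 6) * E (q ^ 12)) := by
    rw [P, Q]; field_simp
  have hT : (2 * J (q ^ 4) 1 * phi (q ^ 6) + 2 * q * phi (q ^ 2) * J (q ^ 12) 1) *
      (2 * J (q ^ 4) 1 * phi (q ^ 6) - 2 * q * phi (q ^ 2) * J (q ^ 12) 1) =
      16 * (E (q ^ 2) * E (q ^ 4) * E (q ^ 6) * E (q ^ 12)) := by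
    rw [← i1, ← i2]; field_simp; ring
  rw [hPQ, mul_pow, mul_pow, h1, h3]
  linear_combination q / 4 * hT

theorem phi_mul_phi {q : ℂ} (hq : ‖q‖ < 1) :
    phi q * phi (q ^ 6) * (phi (q ^ 2) * phi (q ^ 3)) = P q ^ 2 - Q q ^ 2 := by
  rcases eq_or_ne q 0 with rfl | hq0
  · simp [phi_zero, Q_zero, P_zero]
  have n2 := norm_pow_lt_one hq two_ne_zero
  have n3 := norm_pow_lt_one hq three_ne_zero
  have n4 := norm_pow_lt_one hq four_ne_zero
  have n6 := norm_pow_lt_one hq (k := 6) (by norm_num)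
  have n8 := norm_pow_lt_one hq (k := 8) (by norm_num)
  have n12 := norm_pow_lt_one hq (k := 12) (by norm_num)
  have z2 := pow_ne_zero 2 hq0
  have z3 := pow_ne_zero 3 hq0
  have z4 := pow_ne_zero 4 hq0
  have z6 := pow_ne_zero 6 hq0
  have z8 := pow_ne_zero 8 hq0
  have z12 := pow_ne_zero 12 hq0
  have a1 := phi_sq hq0 hq
  have a2 := phi_neg_sq hq0 hq
  have a3 := phi_sq z3 n3
  have a4 := phi_neg_sq z3 n3
  have b1 := phi_eq_add hq0 hq
  have b2 := phi_neg_eq_sub hq0 hq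
  have b3 := phi_eq_add z3 n3
  have b4 := phi_neg_eq_sub z3 n3
  have c1 := J_one_mul_J_one_neg z2 n2
  have c2 := J_one_mul_J_one z8 n8
  have d1 := phi_eq_add z4 n4
  have d2 := phi_neg_eq_sub z4 n4
  have d3 := phi_eq_add z12 n12
  have d4 := phi_neg_eq_sub z12 n12
  simp only [← pow_mul, Nat.reduceMul] at *
  have hD : phi q * phi (-q ^ 3) - phi (-q) * phi (q ^ 3) =
      q * (J (-q ^ 2) 1 * J (-q ^ 6) 1) := by
    rw [c1, b1, b2, b3, b4]; ring
  have hS : phi q * phi (-q ^ 3) + phi (-q) * phi (q ^ 3) =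
      2 * (phi (-q ^ 4) * phi (-q ^ 12)) := by
    have h : phi (q ^ 4) * phi (q ^ 12) - phi (-q ^ 4) * phi (-q ^ 12) =
        q ^ 4 * (J (q ^ 8) 1 * J (q ^ 24) 1) := by
      rw [c2, d1, d2, d3, d4]; ring
    rw [b1, b2, b3, b4]
    linear_combination 2 * h
  -- Multiplied by 2q, both sides become φ(q)²φ(−q³)² − φ(−q)²φ(q³)², the product of the difference
  -- `hD` and the sum `hS`.
  have hN : phi (-q ^ 3) ^ 2 * J (q ^ 4) 1 ^ 2 - q ^ 2 * phi (-q) ^ 2 * J (q ^ 12) 1 ^ 2 =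
      J (-q ^ 2) 1 * J (-q ^ 6) 1 * (phi (-q ^ 4) * phi (-q ^ 12)) := by
    apply mul_left_cancel₀ hq0
    linear_combination (phi q * phi (-q ^ 3) + phi (-q) * phi (q ^ 3)) / 2 * hD +
      q * (J (-q ^ 2) 1 * J (-q ^ 6) 1) / 2 * hS - phi (-q ^ 3) ^ 2 / 2 * (a1 - a2) +
      phi (-q) ^ 2 / 2 * (a3 - a4)
  rw [phi_neg z3 n3, phi_neg hq0 hq, J_one z4 n4, J_one z12 n12, J_neg_one_neg z2 n2,
    J_neg_one_neg z6 n6, phi_neg z4 n4, phi_neg z12 n12] at hN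
  rw [phi_eq_E hq0 hq, phi_eq_E z2 n2, phi_eq_E z3 n3, phi_eq_E z6 n6, P, Q]
  simp only [← pow_mul, Nat.reduceMul] at *
  have e1 := E_ne_zero hq
  have e2 := E_ne_zero n2
  have e3 := E_ne_zero n3
  have e4 := E_ne_zero n4
  have e6 := E_ne_zero n6
  have e8 := E_ne_zero n8
  have e12 := E_ne_zero n12
  have e24 := E_pow_ne_zero hq (k := 24) (by norm_num)
  generalize E q = x1 at *
  generalize E (q ^ 2) = x2 at *
  generalize E (q ^ 3) = x3 at *
  generalize E (q ^ 4) = x4 at *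
  generalize E (q ^ 6) = x6 at *
  generalize E (q ^ 8) = x8 at *
  generalize E (q ^ 12) = x12 at *
  generalize E (q ^ 24) = x24 at *
  have hK : (x3 ^ 2 / x6 * (x8 ^ 2 / x4)) ^ 2 - (q * (x1 ^ 2 / x2) * (x24 ^ 2 / x12)) ^ 2 =
      x2 * x4 * x6 * x12 := by
    have r : (2 * (x2 * x8) / x4) * (2 * (x6 * x24) / x12) *
        (x4 ^ 2 / x8 * (x12 ^ 2 / x24)) = 4 * (x2 * x4 * x6 * x12) := by
      field_simp; ring
    linear_combination (1 / 4) * hN + (1 / 4) * r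
  -- P² − Q² is an eta quotient times a quarter of the left side of `hN`, so it is itself an eta
  -- quotient.
  have hL : (x2 * x3 * x8 * x12 / (x1 * x24)) ^ 2 -
      (q * (x1 * x4 * x6 * x24) / (x3 * x8)) ^ 2 =
      (x2 * x4 * x6 * x12 / (x1 * x3 * x8 * x24)) ^ 2 *
        ((x3 ^ 2 / x6 * (x8 ^ 2 / x4)) ^ 2 - (q * (x1 ^ 2 / x2) * (x24 ^ 2 / x12)) ^ 2) := by
    field_simp
  rw [hL, hK]
  field_simp

/-- On a connected domain (F − G)(F + G) = 0 forces one factor to vanish identically; the common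
nonzero value at 0 excludes F = −G. -/
theorem eq_of_sq_eq_of_eq_at_zero {F G : ℂ → ℂ} (hF : DifferentiableOn ℂ F (Metric.ball 0 1))
    (hG : DifferentiableOn ℂ G (Metric.ball 0 1)) (h : ∀ q ∈ Metric.ball (0 : ℂ) 1,
    F q ^ 2 = G q ^ 2) (h0 : F 0 = G 0) (h1 : F 0 ≠ 0) :
    ∀ q ∈ Metric.ball (0 : ℂ) 1, F q = G q := by
  have hs := (hF.sub hG).analyticOnNhd Metric.isOpen_ball
  have ha := (hF.add hG).analyticOnNhd Metric.isOpen_ball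
  rcases AnalyticOnNhd.eq_zero_or_eq_zero_of_mul_eq_zero hs ha (fun q hq => by
    simp only [Pi.sub_apply, Pi.add_apply]
    linear_combination h q hq) (convex_ball (0 : ℂ) 1).isPreconnected with h2 | h2
  · exact fun q hq => sub_eq_zero.mp (h2 q hq)
  · have := h2 0 (Metric.mem_ball_self one_pos)
    rw [Pi.add_apply, ← h0, ← two_mul] at this
    exact absurd ((mul_eq_zero.mp this).resolve_left two_ne_zero) h1

theorem phi_mul_phi_eq {q : ℂ} (hq : ‖q‖ < 1) :
    phi q * phi (q ^ 6) = P q + Q q ∧ phi (q ^ 2) * phi (q ^ 3) = P q - Q q := by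
  have dA := differentiableOn_phi.mul (differentiableOn_phi_pow (k := 6) (by norm_num))
  have dB := (differentiableOn_phi_pow two_ne_zero).mul (differentiableOn_phi_pow three_ne_zero)
  have key : ∀ c : ℂ, c ^ 2 = -1 → phi q * phi (q ^ 6) + c * (phi (q ^ 2) * phi (q ^ 3)) =
      (P q + Q q) + c * (P q - Q q) := by
    intro c hc
    refine eq_of_sq_eq_of_eq_at_zero (F := fun q => phi q * phi (q ^ 6) +
      c * (phi (q ^ 2) * phi (q ^ 3))) (G := fun q => (P q + Q q) + c * (P q - Q q))
      (dA.add (dB.const_mul c)) ((differentiableOn_P.add differentiableOn_Q).add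
      ((differentiableOn_P.sub differentiableOn_Q).const_mul c)) (fun q hq => ?_) ?_ ?_ q
      (mem_ball_zero_iff.mpr hq)
    · rw [mem_ball_zero_iff] at hq
      linear_combination phi_sq_sub_phi_sq hq + 2 * c * phi_mul_phi hq +
        ((phi (q ^ 2) * phi (q ^ 3)) ^ 2 - (P q - Q q) ^ 2) * hc
    · simp [phi_zero, P_zero, Q_zero]
    · simp only [ne_eq, OfNat.ofNat_ne_zero, not_false_eq_true, zero_pow, phi_zero, mul_one]
      intro h
      have : c = -1 := by linear_combination h
      rw [this] at hc
      norm_num at hc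
  have h1 := key Complex.I Complex.I_sq
  have h2 := key (-Complex.I) (by rw [neg_sq, Complex.I_sq])
  constructor
  · linear_combination (h1 + h2) / 2
  · apply mul_left_cancel₀ Complex.I_ne_zero
    linear_combination (h1 - h2) / 2

/-! ### The bilateral series of the theorem -/

theorem one_add_zpow_ne_zero {q : ℂ} (hq : ‖q‖ < 1) (m : ℤ) : 1 + q ^ m ≠ 0 := by
  intro h
  have h1 : q ^ m = -1 := by linear_combination h
  have h2 : ‖q‖ ^ m = 1 := by rw [← norm_zpow, h1, norm_neg, norm_one]
  rcases eq_or_ne m 0 with rfl | hm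
  · norm_num at h1
  · rw [zpow_eq_one_iff_right₀ (norm_nonneg _) hq.ne] at h2
    exact hm h2

/-- The terms of `∑ q^{kn} / (1 + q^{12n+j})` in the form of Kronecker's series. -/
theorem bilateral_term (q : ℂ) (hq0 : q ≠ 0) (k j : ℕ) (n : ℤ) :
    (q ^ k) ^ n / (1 - (-q ^ j) * (q ^ 12) ^ n) = q ^ (k * n) / (1 + q ^ (12 * n + j)) := by
  rw [zpow_mul, zpow_natCast, zpow_add₀ hq0, zpow_mul, zpow_natCast]
  rw [show q ^ (12 : ℤ) = q ^ 12 from zpow_natCast q 12]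
  ring

theorem bilateral_summable {q : ℂ} (hq0 : q ≠ 0) (hq : ‖q‖ < 1) {k j : ℕ} (hk : k ≠ 0)
    (hk' : k < 12) : Summable fun n : ℤ => q ^ (k * n) / (1 + q ^ (12 * n + j)) := by
  simp only [← bilateral_term q hq0]
  refine summable_bilateral (neg_ne_zero.mpr (pow_ne_zero j hq0)) (pow_ne_zero 12 hq0)
    (norm_pow_lt_one hq (by norm_num)) ?_ (norm_pow_lt_one hq hk)
  rw [norm_pow, norm_pow]
  exact pow_lt_pow_right_of_lt_one₀ (norm_pos_iff.mpr hq0) hq hk'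

theorem bilateral_tsum {q : ℂ} (hq0 : q ≠ 0) (hq : ‖q‖ < 1) {k j : ℕ} (hk : k ≠ 0)
    (hk' : k < 12) : J (q ^ 12) (q ^ j) * J (q ^ 12) (-q ^ k) *
      ∑' n : ℤ, q ^ (k * n) / (1 + q ^ (12 * n + j)) =
        E (q ^ 12) ^ 3 * J (q ^ 12) (q ^ (j + k)) := by
  have hap : ∀ n : ℤ, 1 - (-q ^ j) * (q ^ 12) ^ n ≠ 0 := fun n => by
    have := one_add_zpow_ne_zero hq (12 * n + j)
    rw [zpow_add₀ hq0, zpow_mul, zpow_natCast, show q ^ (12 : ℤ) = q ^ 12 from zpow_natCast q 12]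
      at this
    rwa [neg_mul, sub_neg_eq_add, mul_comm]
  have h := bilateral_eq (neg_ne_zero.mpr (pow_ne_zero j hq0)) (pow_ne_zero 12 hq0)
    (norm_pow_lt_one hq (by norm_num)) hap (x := q ^ k) (by
      rw [norm_pow, norm_pow]
      exact pow_lt_pow_right_of_lt_one₀ (norm_pos_iff.mpr hq0) hq hk') (norm_pow_lt_one hq hk)
  simp only [bilateral_term q hq0] at h
  rwa [neg_neg, ← pow_add] at h

/-- Kronecker's formula with a = −1 and x = q, q⁵: over a common denominator the numerators add up
to the left side of `J_mul_J_add`. -/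
theorem P_eq_tsum {q : ℂ} (hq0 : q ≠ 0) (hq : ‖q‖ < 1) :
    P q = ∑' n : ℤ, q ^ n / (1 + q ^ (12 * n)) + ∑' n : ℤ, q ^ (5 * n) / (1 + q ^ (12 * n)) := by
  have h1 := bilateral_tsum hq0 hq (k := 1) (j := 0) (by norm_num) (by norm_num)
  have h5 := bilateral_tsum hq0 hq (k := 5) (j := 0) (by norm_num) (by norm_num)
  simp only [Nat.cast_one, one_mul, Nat.cast_zero, add_zero, pow_zero, pow_one, zero_add,
    Nat.cast_ofNat] at h1 h5
  have hm := J_twelve_mul hq0 hq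
  have ha := J_mul_J_add hq0 hq
  have n6 := norm_pow_lt_one hq (k := 6) (by norm_num)
  have n8 := norm_pow_lt_one hq (k := 8) (by norm_num)
  have n12 := norm_pow_lt_one hq (k := 12) (by norm_num)
  have i6 := J_four (pow_ne_zero 6 hq0) n6
  have i8 := J_three (pow_ne_zero 8 hq0) n8
  have i12 := J_one (pow_ne_zero 12 hq0) n12
  simp only [← pow_mul, Nat.reduceMul] at i6 i8 i12
  rw [i6, i8] at ha
  rw [i12] at h1 h5
  have e1 := E_ne_zero hq
  have e2 := E_pow_ne_zero hq (k := 2) (by norm_num)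
  have e3 := E_pow_ne_zero hq (k := 3) (by norm_num)
  have e6 := E_ne_zero n6
  have e12 := E_ne_zero n12
  have e24 := E_pow_ne_zero hq (k := 24) (by norm_num)
  have hne : 2 * E (q ^ 24) ^ 2 / E (q ^ 12) * (J (q ^ 12) (-q) * J (q ^ 12) (-q ^ 5)) ≠ 0 := by
    rw [hm]
    simp [e1, e2, e3, e6, e12, e24]
  apply mul_left_cancel₀ hne
  have hR : 2 * E (q ^ 24) ^ 2 / E (q ^ 12) * (J (q ^ 12) (-q) * J (q ^ 12) (-q ^ 5)) *
      (∑' n : ℤ, q ^ n / (1 + q ^ (12 * n)) + ∑' n : ℤ, q ^ (5 * n) / (1 + q ^ (12 * n))) =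
      E (q ^ 12) ^ 3 * (2 * (E (q ^ 24) * E (q ^ 6) / E (q ^ 12) * E (q ^ 8))) := by
    rw [← ha]
    linear_combination J (q ^ 12) (-q ^ 5) * h1 + J (q ^ 12) (-q) * h5
  rw [hR, hm, P]
  field_simp

/-- Kronecker's formula with a = −q⁴ and x = q³, q⁹: the denominators agree by the reflection
`J_div`, and the numerators combine to q E(q) by `J_twelve_sub`. -/
theorem Q_eq_tsum {q : ℂ} (hq0 : q ≠ 0) (hq : ‖q‖ < 1) :
    Q q = ∑' n : ℤ, q ^ (3 * n + 1) / (1 + q ^ (12 * n + 4)) -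
      ∑' n : ℤ, q ^ (9 * n + 3) / (1 + q ^ (12 * n + 4)) := by
  have h3 := bilateral_tsum hq0 hq (k := 3) (j := 4) (by norm_num) (by norm_num)
  have h9 := bilateral_tsum hq0 hq (k := 9) (j := 4) (by norm_num) (by norm_num)
  simp only [Nat.cast_ofNat, Nat.reduceAdd] at h3 h9
  have t3 : ∑' n : ℤ, q ^ (3 * n + 1) / (1 + q ^ (12 * n + 4)) =
      q * ∑' n : ℤ, q ^ (3 * n) / (1 + q ^ (12 * n + 4)) := by
    rw [← tsum_mul_left]
    refine tsum_congr fun n => ?_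
    rw [zpow_add_one₀ hq0]; ring
  have t9 : ∑' n : ℤ, q ^ (9 * n + 3) / (1 + q ^ (12 * n + 4)) =
      q ^ 3 * ∑' n : ℤ, q ^ (9 * n) / (1 + q ^ (12 * n + 4)) := by
    rw [← tsum_mul_left]
    refine tsum_congr fun n => ?_
    rw [zpow_add₀ hq0, show q ^ (3 : ℤ) = q ^ 3 from zpow_natCast q 3]; ring
  have z12 := pow_ne_zero 12 hq0
  have j9 : J (q ^ 12) (-q ^ 9) = J (q ^ 12) (-q ^ 3) := by
    rw [← J_div z12, show q ^ 12 / -q ^ 9 = -q ^ 3 by field_simp]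
  have j13 : q * J (q ^ 12) (q ^ 13) = J (q ^ 12) q := by
    rw [← J_mul_base z12 hq0, ← pow_succ]
  have hs := J_twelve_sub hq0 hq
  have n3 := norm_pow_lt_one hq (k := 3) (by norm_num)
  have n4 := norm_pow_lt_one hq (k := 4) (by norm_num)
  have i3 := J_four (pow_ne_zero 3 hq0) n3
  have i4 := J_three_pos (pow_ne_zero 4 hq0) n4
  simp only [← pow_mul, Nat.reduceMul] at i3 i4
  rw [j9] at h9
  rw [i3, i4] at h3 h9
  have e1 := E_ne_zero hq
  have e3 := E_ne_zero n3
  have e4 := E_ne_zero n4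
  have e6 := E_pow_ne_zero hq (k := 6) (by norm_num)
  have e8 := E_pow_ne_zero hq (k := 8) (by norm_num)
  have e12 := E_pow_ne_zero hq (k := 12) (by norm_num)
  have e24 := E_pow_ne_zero hq (k := 24) (by norm_num)
  have hne : E (q ^ 8) * E (q ^ 12) ^ 2 / (E (q ^ 4) * E (q ^ 24)) *
      (E (q ^ 12) * E (q ^ 3) / E (q ^ 6)) ≠ 0 := by
    simp [e3, e4, e6, e8, e12, e24]
  apply mul_left_cancel₀ hne
  rw [t3, t9]
  have hR : E (q ^ 8) * E (q ^ 12) ^ 2 / (E (q ^ 4) * E (q ^ 24)) *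
      (E (q ^ 12) * E (q ^ 3) / E (q ^ 6)) *
      (q * ∑' n : ℤ, q ^ (3 * n) / (1 + q ^ (12 * n + 4)) -
        q ^ 3 * ∑' n : ℤ, q ^ (9 * n) / (1 + q ^ (12 * n + 4))) =
      E (q ^ 12) ^ 3 * (q * E q) := by
    rw [← hs, ← j13]
    linear_combination q * h3 - q ^ 3 * h9
  rw [hR, Q]
  field_simp

theorem bijective_int_three : Function.Bijective (Sum.elim (fun n : ℤ => 3 * n)
    (Sum.elim (fun n : ℤ => 3 * n + 1) fun n : ℤ => -(3 * n + 1))) := by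
  constructor
  · rintro (a | a | a) (b | b | b) h <;> simp at h ⊢ <;> omega
  · intro n
    have h : n % 3 = 0 ∨ n % 3 = 1 ∨ n % 3 = 2 := by omega
    rcases h with h | h | h
    · exact ⟨Sum.inl (n / 3), by simp; omega⟩
    · exact ⟨Sum.inr (Sum.inl (n / 3)), by simp; omega⟩
    · exact ⟨Sum.inr (Sum.inr (-(n / 3) - 1)), by simp; omega⟩

theorem tsum_int_three {f : ℤ → ℂ} (hf : Summable f) :
    ∑' n, f n = ∑' n, f (3 * n) + (∑' n, f (3 * n + 1) + ∑' n, f (-(3 * n + 1))) := by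
  have hi := bijective_int_three.1
  have h1 := hf.comp_injective (fun a b h => Sum.inl_injective (hi h))
  have h2 := hf.comp_injective (i := fun n : ℤ => 3 * n + 1) (fun a b h => by simpa using h)
  have h3 := hf.comp_injective (i := fun n : ℤ => -(3 * n + 1)) (fun a b h => by simpa using h)
  rw [tsum_eq_add_of_bijective hf _ _ bijective_int_three]
  congr 1
  exact Summable.tsum_sum (f := fun c => f (Sum.elim _ _ c)) h2 h3

theorem summable_geometric_div {q : ℂ} (hq0 : q ≠ 0) (hq : ‖q‖ < 1) :
    Summable fun n : ℤ => q ^ n / (1 + q ^ (4 * n)) := by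
  refine (summable_bilateral (a := -1) (p := q ^ 4) (x := q) (by simp) (pow_ne_zero 4 hq0)
    (norm_pow_lt_one hq four_ne_zero) ?_ hq).congr fun n => ?_
  · rw [norm_pow]
    exact pow_lt_self_of_lt_one₀ (norm_pos_iff.mpr hq0) hq (by norm_num)
  · rw [zpow_mul, show q ^ (4 : ℤ) = q ^ 4 from zpow_natCast q 4]
    ring

theorem geometric_div_neg {q : ℂ} (hq0 : q ≠ 0) (hq : ‖q‖ < 1) (n : ℤ) :
    q ^ (-n) / (1 + q ^ (4 * -n)) = q ^ (3 * n) / (1 + q ^ (4 * n)) := by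
  rw [div_eq_div_iff (one_add_zpow_ne_zero hq _) (one_add_zpow_ne_zero hq _), mul_add, mul_add,
    ← zpow_add₀ hq0, ← zpow_add₀ hq0, mul_one, mul_one, add_comm]
  congr 2 <;> ring

/-- Evaluate ∑ qⁿ/(1 + q⁴ⁿ) in two ways: with y = qⁿ, as ∑ (y − y⁵ + y⁹)/(1 + y¹²), and by the
classes 3n, 3n + 1, −(3n + 1). The y⁹ part cancels against the multiples of 3 after n ↦ −n. -/
theorem tsum_sub_eq_add {q : ℂ} (hq0 : q ≠ 0) (hq : ‖q‖ < 1) :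
    ∑' n : ℤ, q ^ n / (1 + q ^ (12 * n)) - ∑' n : ℤ, q ^ (5 * n) / (1 + q ^ (12 * n)) =
      ∑' n : ℤ, q ^ (3 * n + 1) / (1 + q ^ (12 * n + 4)) +
        ∑' n : ℤ, q ^ (9 * n + 3) / (1 + q ^ (12 * n + 4)) := by
  have s1 := bilateral_summable hq0 hq (k := 1) (j := 0) (by norm_num) (by norm_num)
  have s5 := bilateral_summable hq0 hq (k := 5) (j := 0) (by norm_num) (by norm_num)
  have s9 := bilateral_summable hq0 hq (k := 9) (j := 0) (by norm_num) (by norm_num)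
  simp only [Nat.cast_one, one_mul, Nat.cast_zero, add_zero, Nat.cast_ofNat] at s1 s5 s9
  have hW : ∑' n : ℤ, q ^ n / (1 + q ^ (4 * n)) =
      ∑' n : ℤ, q ^ n / (1 + q ^ (12 * n)) - ∑' n : ℤ, q ^ (5 * n) / (1 + q ^ (12 * n)) +
        ∑' n : ℤ, q ^ (9 * n) / (1 + q ^ (12 * n)) := by
    rw [← s1.tsum_sub s5, ← (s1.sub s5).tsum_add s9]
    refine tsum_congr fun n => ?_
    have h4 := one_add_zpow_ne_zero hq (4 * n)
    have h12 := one_add_zpow_ne_zero hq (12 * n)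
    have e : ∀ k : ℕ, q ^ ((k : ℤ) * n) = (q ^ n) ^ k := fun k => by
      rw [← zpow_natCast, ← zpow_mul, mul_comm]
    have e4 := e 4
    have e5 := e 5
    have e9 := e 9
    have e12 := e 12
    simp only [Nat.cast_ofNat] at e4 e5 e9 e12
    rw [e4] at h4
    rw [e12] at h12
    rw [e4, e5, e9, e12]
    field_simp
    ring
  have h9 : ∑' n : ℤ, q ^ (9 * n) / (1 + q ^ (12 * n)) =
      ∑' n : ℤ, q ^ (3 * n) / (1 + q ^ (4 * (3 * n))) := by
    rw [← (Equiv.neg ℤ).tsum_eq (fun n : ℤ => q ^ (3 * n) / (1 + q ^ (4 * (3 * n))))]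
    refine tsum_congr fun n => ?_
    rw [Equiv.neg_apply, mul_neg, geometric_div_neg hq0 hq, show 3 * (3 * n) = 9 * n by ring,
      show 4 * (3 * n) = 12 * n by ring]
  rw [tsum_int_three (summable_geometric_div hq0 hq), h9, add_comm] at hW
  have hT : ∑' n : ℤ, q ^ (3 * n + 1) / (1 + q ^ (4 * (3 * n + 1))) +
      ∑' n : ℤ, q ^ (-(3 * n + 1)) / (1 + q ^ (4 * -(3 * n + 1))) =
      ∑' n : ℤ, q ^ n / (1 + q ^ (12 * n)) - ∑' n : ℤ, q ^ (5 * n) / (1 + q ^ (12 * n)) :=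
    add_right_cancel hW
  rw [← hT]
  congr 1 <;> refine tsum_congr fun n => ?_
  · congr 3; ring
  · rw [geometric_div_neg hq0 hq]
    congr 3 <;> ring

/-! ### Lambert series -/

theorem legendreSym_three_mul (n : ℤ) : legendreSym 3 (3 * n) = 0 := by
  rw [legendreSym.mod, show 3 * n % ((3 : ℕ) : ℤ) = 0 by omega]; decide

theorem legendreSym_three_mul_add_one (n : ℤ) : legendreSym 3 (3 * n + 1) = 1 := by
  rw [legendreSym.mod, show (3 * n + 1) % ((3 : ℕ) : ℤ) = 1 by omega]; decide

theorem legendreSym_three_neg (n : ℤ) : legendreSym 3 (-n) = -legendreSym 3 n := by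
  rw [neg_eq_neg_one_mul, legendreSym.mul, show legendreSym 3 (-1) = -1 by decide, neg_one_mul]

theorem norm_legendreSym_three_le (n : ℤ) : ‖(legendreSym 3 n : ℂ)‖ ≤ 1 := by
  by_cases h : (n : ZMod 3) = 0
  · rw [(legendreSym.eq_zero_iff 3 n).mpr h]; simp
  · rcases legendreSym.eq_one_or_neg_one 3 h with h | h <;> simp [h]

theorem summable_legendreSym_lambert {q : ℂ} (hq0 : q ≠ 0) (hq : ‖q‖ < 1) :
    Summable fun n : ℤ => (legendreSym 3 n : ℂ) * (q ^ n / (1 + q ^ (4 * n))) := by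
  refine Summable.of_norm_bounded (summable_geometric_div hq0 hq).norm fun n => ?_
  rw [norm_mul]
  exact mul_le_of_le_one_left (norm_nonneg _) (norm_legendreSym_three_le n)

/-- Both sides equal ∑ (n/3) qⁿ/(1 + q⁴ⁿ) over all integers: one pairs n with −n, the other splits
modulo 3. -/
theorem hasSum_legendreSym_lambert {q : ℂ} (hq0 : q ≠ 0) (hq : ‖q‖ < 1) :
    HasSum (fun n : ℕ+ => (legendreSym 3 ((n : ℕ) : ℤ) : ℂ) *
      (q ^ (n : ℕ) * (1 - q ^ (2 * (n : ℕ))) / (1 + q ^ (4 * (n : ℕ)))))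
      (∑' n : ℤ, q ^ (3 * n + 1) / (1 + q ^ (12 * n + 4)) -
        ∑' n : ℤ, q ^ (9 * n + 3) / (1 + q ^ (12 * n + 4))) := by
  have hs := summable_legendreSym_lambert hq0 hq
  have hp := hs.comp_injective (i := fun n : ℕ+ => ((n : ℕ) : ℤ)) (fun a b h => by simpa using h)
  have hn := hs.comp_injective (i := fun n : ℕ+ => -((n : ℕ) : ℤ)) (fun a b h => by simpa using h)
  have h1 := tsum_int_three hs
  have h2 := tsum_int_eq_zero_add_tsum_pnat hs
  have h3 : ∑' n : ℤ, (legendreSym 3 n : ℂ) * (q ^ n / (1 + q ^ (4 * n))) =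
      ∑' n : ℤ, q ^ (3 * n + 1) / (1 + q ^ (12 * n + 4)) -
        ∑' n : ℤ, q ^ (9 * n + 3) / (1 + q ^ (12 * n + 4)) := by
    rw [h1]
    simp only [legendreSym_three_neg, legendreSym_three_mul, legendreSym_three_mul_add_one,
      geometric_div_neg hq0 hq]
    simp only [Int.cast_zero, zero_mul, tsum_zero, zero_add, Int.cast_one, one_mul, Int.cast_neg,
      neg_mul, tsum_neg, ← sub_eq_add_neg]
    congr 1 <;> refine tsum_congr fun n => ?_ <;> congr 3 <;> ring
  rw [← h3, h2]
  refine HasSum.congr_fun ?_ (fun n => ?_) (f := fun n : ℕ+ =>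
    (legendreSym 3 ((n : ℕ) : ℤ) : ℂ) * (q ^ ((n : ℕ) : ℤ) / (1 + q ^ (4 * ((n : ℕ) : ℤ)))) +
    (legendreSym 3 (-((n : ℕ) : ℤ)) : ℂ) *
      (q ^ (-((n : ℕ) : ℤ)) / (1 + q ^ (4 * -((n : ℕ) : ℤ)))))
  · rw [legendreSym.at_zero, Int.cast_zero, zero_mul, zero_add]
    exact hp.hasSum.add hn.hasSum
  · rw [geometric_div_neg hq0 hq, legendreSym_three_neg]
    have e : ∀ k : ℕ, q ^ ((k : ℤ) * (n : ℕ)) = q ^ (k * (n : ℕ)) := fun k => by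
      rw [← Nat.cast_mul, zpow_natCast]
    have e3 := e 3
    have e4 := e 4
    simp only [Nat.cast_ofNat] at e3 e4
    rw [e3, e4, zpow_natCast]
    push_cast
    ring

/-- The primitive Dirichlet character modulo `24` of discriminant `-24`. -/
def chi (m : ℕ) : ℤ :=
  if m % 24 ∈ ({1, 5, 7, 11} : Finset ℕ) then 1
  else if m % 24 ∈ ({13, 17, 19, 23} : Finset ℕ) then -1 else 0

theorem kronecker_eq_jacobiSym (a : ℤ) {n : ℕ} (hn : Odd n) : kronecker a n = jacobiSym a n := by
  rw [kronecker, jacobiSym]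
  congr 1
  refine List.pmap_congr_left _ fun p hp h1 h2 => ?_
  rw [if_neg]
  rintro rfl
  exact Nat.not_even_iff_odd.mpr hn (even_iff_two_dvd.mpr (Nat.dvd_of_mem_primeFactorsList hp))

/-- For odd n the symbol depends only on n modulo 4·6 = 24; for even n the prime 2 contributes a
factor 0. -/
theorem kronecker_neg_six {n : ℕ} (hn : n ≠ 0) : kronecker (-6) n = chi n := by
  rcases Nat.even_or_odd n with he | ho
  · have h0 : chi n = 0 := by
      obtain ⟨k, rfl⟩ := he
      rw [chi, if_neg, if_neg] <;> simp <;> omega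
    rw [h0, kronecker]
    refine List.prod_eq_zero (List.mem_pmap.mpr ⟨2, ?_, ?_⟩)
    · exact (Nat.mem_primeFactorsList hn).mpr ⟨Nat.prime_two, he.two_dvd⟩
    · rw [if_pos rfl]; decide
  · rw [kronecker_eq_jacobiSym _ ho, jacobiSym.mod_right _ ho, chi]
    have h24 : n % (4 * (-6 : ℤ).natAbs) = n % 24 := rfl
    have hodd : n % 24 % 2 = 1 := by obtain ⟨k, rfl⟩ := ho; omega
    have hlt : n % 24 < 24 := Nat.mod_lt _ (by norm_num)
    rw [h24]
    generalize n % 24 = r at *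
    interval_cases r <;> first | omega | (norm_num)

theorem chi_add_twelve (m : ℕ) : chi (m + 12) = -chi m := by
  have h : (m + 12) % 24 = (m % 24 + 12) % 24 := by omega
  have hlt : m % 24 < 24 := Nat.mod_lt _ (by norm_num)
  rw [chi, chi, h]
  generalize m % 24 = r at *
  interval_cases r <;> rfl

theorem norm_chi_le (m : ℕ) : ‖(chi m : ℂ)‖ ≤ 1 := by
  rw [chi]
  split_ifs <;> simp

theorem hasSum_chi_mul_pow {y : ℂ} (hy : ‖y‖ < 1) :
    HasSum (fun m : ℕ+ => (chi m : ℂ) * y ^ (m : ℕ))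
      ((y + y ^ 5 + y ^ 7 + y ^ 11) / (1 + y ^ 12)) := by
  have hs : Summable fun m : ℕ => (chi m : ℂ) * y ^ m := by
    refine Summable.of_norm_bounded (summable_geometric_of_lt_one (norm_nonneg _) hy) fun m => ?_
    rw [norm_mul, norm_pow]
    exact mul_le_of_le_one_left (by positivity) (norm_chi_le m)
  rw [hasSum_pnat_iff (f := fun m : ℕ => (chi m : ℂ) * y ^ m),
    show chi 0 = 0 by rfl, Int.cast_zero, zero_mul, add_zero]
  have h12 : 1 + y ^ 12 ≠ 0 := by
    have := one_add_zpow_ne_zero hy 12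
    rwa [show y ^ (12 : ℤ) = y ^ 12 from zpow_natCast y 12] at this
  suffices h : ∑' m : ℕ, (chi m : ℂ) * y ^ m = (y + y ^ 5 + y ^ 7 + y ^ 11) / (1 + y ^ 12) by
    rw [← h]; exact hs.hasSum
  rw [eq_div_iff h12]
  have h := hs.sum_add_tsum_nat_add 12
  have h' : ∑' m : ℕ, (chi (m + 12) : ℂ) * y ^ (m + 12) =
      -y ^ 12 * ∑' m : ℕ, (chi m : ℂ) * y ^ m := by
    rw [← tsum_mul_left]
    refine tsum_congr fun m => ?_
    rw [chi_add_twelve]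
    push_cast
    ring
  have hfin : ∑ m ∈ Finset.range 12, (chi m : ℂ) * y ^ m = y + y ^ 5 + y ^ 7 + y ^ 11 := by
    simp [Finset.sum_range_succ, chi]
  rw [h', hfin] at h
  linear_combination -h

/-- Sum χ(m) q^(nm) over m, n ≥ 1 in both orders. Summing over n gives the Lambert series; summing
over m gives the terms n and −n of the bilateral series together. The −1 removes its term at n = 0.
-/
theorem hasSum_kronecker_lambert {q : ℂ} (hq0 : q ≠ 0) (hq : ‖q‖ < 1) :
    HasSum (fun n : ℕ+ => (kronecker (-6) n : ℂ) * (q ^ (n : ℕ) / (1 - q ^ (n : ℕ))))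
      (∑' n : ℤ, q ^ n / (1 + q ^ (12 * n)) + ∑' n : ℤ, q ^ (5 * n) / (1 + q ^ (12 * n)) - 1) := by
  have hd : Summable fun c : ℕ+ × ℕ+ => (chi c.2 : ℂ) * q ^ (c.1 * c.2 : ℕ) := by
    refine Summable.of_norm_bounded (summable_prod_mul_pow 0 hq).norm fun c => ?_
    rw [pow_zero, one_mul, norm_mul]
    exact mul_le_of_le_one_left (norm_nonneg _) (norm_chi_le _)
  have hrow : ∀ n : ℕ+, HasSum (fun m : ℕ+ => (chi m : ℂ) * q ^ (n * m : ℕ))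
      ((q ^ (n : ℕ) + (q ^ (n : ℕ)) ^ 5 + (q ^ (n : ℕ)) ^ 7 + (q ^ (n : ℕ)) ^ 11) /
        (1 + (q ^ (n : ℕ)) ^ 12)) := fun n => by
    simpa only [pow_mul] using hasSum_chi_mul_pow (norm_pow_lt_one hq n.ne_zero)
  have hcol : ∀ m : ℕ+, HasSum (fun n : ℕ+ => (chi m : ℂ) * q ^ (n * m : ℕ))
      ((kronecker (-6) m : ℂ) * (q ^ (m : ℕ) / (1 - q ^ (m : ℕ)))) := fun m => by
    rw [kronecker_neg_six m.ne_zero]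
    refine HasSum.mul_left _ ?_
    rw [hasSum_pnat_iff_hasSum_succ (f := fun n : ℕ => q ^ (n * (m : ℕ)))]
    refine ((hasSum_geometric_of_norm_lt_one (norm_pow_lt_one hq m.ne_zero)).mul_left
      (q ^ (m : ℕ))).congr_fun fun n => ?_
    ring
  have h1 := hd.hasSum.prod_fiberwise hrow
  have h2 := hd.prod_symm.hasSum.prod_fiberwise hcol
  have hswap : ∑' c : ℕ+ × ℕ+, (chi c.swap.2 : ℂ) * q ^ (c.swap.1 * c.swap.2 : ℕ) =
      ∑' c : ℕ+ × ℕ+, (chi c.2 : ℂ) * q ^ (c.1 * c.2 : ℕ) :=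
    (Equiv.prodComm ℕ+ ℕ+).tsum_eq (fun c : ℕ+ × ℕ+ => (chi c.2 : ℂ) * q ^ (c.1 * c.2 : ℕ))
  rw [hswap] at h2
  have s1 := bilateral_summable hq0 hq (k := 1) (j := 0) (by norm_num) (by norm_num)
  have s5 := bilateral_summable hq0 hq (k := 5) (j := 0) (by norm_num) (by norm_num)
  simp only [Nat.cast_one, one_mul, Nat.cast_zero, add_zero, Nat.cast_ofNat] at s1 s5
  have hs := s1.add s5
  have hp := hs.comp_injective (i := fun n : ℕ+ => ((n : ℕ) : ℤ)) (fun a b h => by simpa using h)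
  have hn := hs.comp_injective (i := fun n : ℕ+ => -((n : ℕ) : ℤ)) (fun a b h => by simpa using h)
  convert h2 using 1
  rw [← h1.tsum_eq, ← s1.tsum_add s5, tsum_int_eq_zero_add_tsum_pnat hs, add_assoc]
  have h0 : q ^ (0 : ℤ) / (1 + q ^ (12 * (0 : ℤ))) + q ^ (5 * (0 : ℤ)) / (1 + q ^ (12 * (0 : ℤ))) =
      1 := by norm_num
  rw [h0, add_sub_cancel_left]
  refine (hp.tsum_add hn).symm.trans (tsum_congr fun n => ?_)
  simp only [Function.comp]
  have h12 : 1 + (q ^ (n : ℕ)) ^ 12 ≠ 0 := by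
    have := one_add_zpow_ne_zero (norm_pow_lt_one hq n.ne_zero) 12
    rwa [show (q ^ (n : ℕ)) ^ (12 : ℤ) = (q ^ (n : ℕ)) ^ 12 from zpow_natCast _ 12] at this
  have hy : q ^ (n : ℕ) ≠ 0 := pow_ne_zero _ hq0
  have e : ∀ k : ℕ, q ^ ((k : ℤ) * ((n : ℕ) : ℤ)) = (q ^ (n : ℕ)) ^ k := fun k => by
    rw [← Nat.cast_mul, zpow_natCast, mul_comm, pow_mul]
  have e5 := e 5
  have e12 := e 12
  simp only [Nat.cast_ofNat] at e5 e12
  rw [mul_neg, mul_neg, zpow_neg, zpow_neg, zpow_neg, e5, e12, zpow_natCast]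
  generalize q ^ (n : ℕ) = y at *
  have h12' : 1 + (y ^ 12)⁻¹ ≠ 0 := by
    have : 1 + (y ^ 12)⁻¹ = (1 + y ^ 12) / y ^ 12 := by field_simp; ring
    rw [this]
    exact div_ne_zero h12 (pow_ne_zero _ hy)
  have h12'' : y ^ 12 + 1 ≠ 0 := by rwa [add_comm]
  field_simp
  ring

theorem summable_and_eq_tsum {q : ℂ} (hq : ‖q‖ < 1) :
    Summable (fun n : ℤ => q ^ n / (1 + q ^ (12 * n))) ∧
    Summable (fun n : ℤ => q ^ (5 * n) / (1 + q ^ (12 * n))) ∧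
    Summable (fun n : ℤ => q ^ (3 * n + 1) / (1 + q ^ (12 * n + 4))) ∧
    Summable (fun n : ℤ => q ^ (9 * n + 3) / (1 + q ^ (12 * n + 4))) ∧
    P q = ∑' n : ℤ, q ^ n / (1 + q ^ (12 * n)) + ∑' n : ℤ, q ^ (5 * n) / (1 + q ^ (12 * n)) ∧
    Q q = ∑' n : ℤ, q ^ (3 * n + 1) / (1 + q ^ (12 * n + 4)) -
      ∑' n : ℤ, q ^ (9 * n + 3) / (1 + q ^ (12 * n + 4)) ∧
    ∑' n : ℤ, q ^ n / (1 + q ^ (12 * n)) - ∑' n : ℤ, q ^ (5 * n) / (1 + q ^ (12 * n)) =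
      ∑' n : ℤ, q ^ (3 * n + 1) / (1 + q ^ (12 * n + 4)) +
        ∑' n : ℤ, q ^ (9 * n + 3) / (1 + q ^ (12 * n + 4)) ∧
    HasSum (fun n : ℕ+ => (kronecker (-6) n : ℂ) * (q ^ (n : ℕ) / (1 - q ^ (n : ℕ))))
      (P q - 1) ∧
    HasSum (fun n : ℕ+ => (legendreSym 3 ((n : ℕ) : ℤ) : ℂ) *
      (q ^ (n : ℕ) * (1 - q ^ (2 * (n : ℕ))) / (1 + q ^ (4 * (n : ℕ))))) (Q q) := by
  rcases eq_or_ne q 0 with rfl | hq0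
  -- At q = 0 the convention 0ⁿ = 0 for n ≠ 0, negative n included, agrees with the limits of the
  -- terms; only n = 0 contributes, with value 1/2, to each of the first two series.
  · have h1 : HasSum (fun n : ℤ => (0 : ℂ) ^ n / (1 + 0 ^ (12 * n))) (1 / 2) := by
      convert hasSum_single (0 : ℤ) (fun n hn => ?_) using 1
      · norm_num
      · rw [zero_zpow n hn, zero_div]
    have h5 : HasSum (fun n : ℤ => (0 : ℂ) ^ (5 * n) / (1 + 0 ^ (12 * n))) (1 / 2) := by
      convert hasSum_single (0 : ℤ) (fun n hn => ?_) using 1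
      · norm_num
      · rw [zero_zpow _ (by omega), zero_div]
    have h3 : HasSum (fun n : ℤ => (0 : ℂ) ^ (3 * n + 1) / (1 + 0 ^ (12 * n + 4))) 0 :=
      hasSum_zero.congr_fun fun n => by rw [zero_zpow _ (by omega), zero_div]
    have h9 : HasSum (fun n : ℤ => (0 : ℂ) ^ (9 * n + 3) / (1 + 0 ^ (12 * n + 4))) 0 :=
      hasSum_zero.congr_fun fun n => by rw [zero_zpow _ (by omega), zero_div]
    rw [h1.tsum_eq, h5.tsum_eq, h3.tsum_eq, h9.tsum_eq, P_zero, Q_zero]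
    refine ⟨h1.summable, h5.summable, h3.summable, h9.summable, by norm_num, by norm_num,
      by norm_num, ?_, ?_⟩
    · rw [sub_self]
      exact hasSum_zero.congr_fun fun n => by rw [zero_pow n.ne_zero, zero_div, mul_zero]
    · exact hasSum_zero.congr_fun fun n => by rw [zero_pow n.ne_zero, zero_mul, zero_div, mul_zero]
  · have s1 := bilateral_summable hq0 hq (k := 1) (j := 0) (by norm_num) (by norm_num)
    have s5 := bilateral_summable hq0 hq (k := 5) (j := 0) (by norm_num) (by norm_num)
    have s3 := bilateral_summable hq0 hq (k := 3) (j := 4) (by norm_num) (by norm_num)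
    have s9 := bilateral_summable hq0 hq (k := 9) (j := 4) (by norm_num) (by norm_num)
    simp only [Nat.cast_one, one_mul, Nat.cast_zero, add_zero, Nat.cast_ofNat] at s1 s5 s3 s9
    refine ⟨s1, s5, (s3.mul_left q).congr fun n => ?_, (s9.mul_left (q ^ 3)).congr fun n => ?_,
      P_eq_tsum hq0 hq, Q_eq_tsum hq0 hq, tsum_sub_eq_add hq0 hq, ?_, ?_⟩
    · rw [zpow_add_one₀ hq0]; ring
    · rw [zpow_add₀ hq0 (9 * n), show q ^ (3 : ℤ) = q ^ 3 from zpow_natCast q 3]; ring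
    · rw [P_eq_tsum hq0 hq]
      exact hasSum_kronecker_lambert hq0 hq
    · rw [Q_eq_tsum hq0 hq]
      exact hasSum_legendreSym_lambert hq0 hq

end ThetaLambert

theorem theorem4p1 (q : ℂ) (hq : ‖q‖ < 1) :
    -- all the series that occur converge absolutely
    Summable (fun n : ℤ => q ^ n / (1 + q ^ (12 * n))) ∧
    Summable (fun n : ℤ => q ^ (5 * n) / (1 + q ^ (12 * n))) ∧
    Summable (fun n : ℤ => q ^ (3 * n + 1) / (1 + q ^ (12 * n + 4))) ∧
    Summable (fun n : ℤ => q ^ (9 * n + 3) / (1 + q ^ (12 * n + 4))) ∧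
    Summable (fun n : ℤ => (q ^ n + q ^ (5 * n)) / (1 + q ^ (12 * n))) ∧
    Summable (fun n : ℤ => (q ^ (3 * n + 1) - q ^ (9 * n + 3)) / (1 + q ^ (12 * n + 4))) ∧
    Summable (fun n : ℕ+ =>
      (ThetaLambert.kronecker (-6) n : ℂ) * (q ^ (n : ℕ) / (1 - q ^ (n : ℕ)))) ∧
    Summable (fun n : ℕ+ => (legendreSym 3 ((n : ℕ) : ℤ) : ℂ) *
      (q ^ (n : ℕ) * (1 - q ^ (2 * (n : ℕ))) / (1 + q ^ (4 * (n : ℕ))))) ∧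
    -- the expansions of `P(q)`
    ThetaLambert.P q = ∑' n : ℤ, (q ^ n + q ^ (5 * n)) / (1 + q ^ (12 * n)) ∧
    ThetaLambert.P q = 1 + ∑' n : ℕ+,
      (ThetaLambert.kronecker (-6) n : ℂ) * (q ^ (n : ℕ) / (1 - q ^ (n : ℕ))) ∧
    -- the expansions of `Q(q)`
    ThetaLambert.Q q =
      ∑' n : ℤ, (q ^ (3 * n + 1) - q ^ (9 * n + 3)) / (1 + q ^ (12 * n + 4)) ∧
    ThetaLambert.Q q = ∑' n : ℕ+, (legendreSym 3 ((n : ℕ) : ℤ) : ℂ) *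
      (q ^ (n : ℕ) * (1 - q ^ (2 * (n : ℕ))) / (1 + q ^ (4 * (n : ℕ)))) ∧
    -- the expressions for `φ(q)φ(q⁶)`
    ThetaLambert.phi q * ThetaLambert.phi (q ^ 6) = ThetaLambert.P q + ThetaLambert.Q q ∧
    ThetaLambert.phi q * ThetaLambert.phi (q ^ 6) =
      (∑' n : ℤ, (q ^ n + q ^ (5 * n)) / (1 + q ^ (12 * n))) +
        ∑' n : ℤ, (q ^ (3 * n + 1) - q ^ (9 * n + 3)) / (1 + q ^ (12 * n + 4)) ∧
    ThetaLambert.phi q * ThetaLambert.phi (q ^ 6) =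
      2 * ((∑' n : ℤ, q ^ n / (1 + q ^ (12 * n))) -
        ∑' n : ℤ, q ^ (9 * n + 3) / (1 + q ^ (12 * n + 4))) ∧
    ThetaLambert.phi q * ThetaLambert.phi (q ^ 6) =
      2 * ((∑' n : ℤ, q ^ (5 * n) / (1 + q ^ (12 * n))) +
        ∑' n : ℤ, q ^ (3 * n + 1) / (1 + q ^ (12 * n + 4))) ∧
    ThetaLambert.phi q * ThetaLambert.phi (q ^ 6) =
      1 + (∑' n : ℕ+,
        (ThetaLambert.kronecker (-6) n : ℂ) * (q ^ (n : ℕ) / (1 - q ^ (n : ℕ)))) +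
        ∑' n : ℕ+, (legendreSym 3 ((n : ℕ) : ℤ) : ℂ) *
          (q ^ (n : ℕ) * (1 - q ^ (2 * (n : ℕ))) / (1 + q ^ (4 * (n : ℕ)))) ∧
    -- the expressions for `φ(q²)φ(q³)`
    ThetaLambert.phi (q ^ 2) * ThetaLambert.phi (q ^ 3) =
      ThetaLambert.P q - ThetaLambert.Q q ∧
    ThetaLambert.phi (q ^ 2) * ThetaLambert.phi (q ^ 3) =
      (∑' n : ℤ, (q ^ n + q ^ (5 * n)) / (1 + q ^ (12 * n))) -
        ∑' n : ℤ, (q ^ (3 * n + 1) - q ^ (9 * n + 3)) / (1 + q ^ (12 * n + 4)) ∧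
    ThetaLambert.phi (q ^ 2) * ThetaLambert.phi (q ^ 3) =
      2 * ((∑' n : ℤ, q ^ n / (1 + q ^ (12 * n))) -
        ∑' n : ℤ, q ^ (3 * n + 1) / (1 + q ^ (12 * n + 4))) ∧
    ThetaLambert.phi (q ^ 2) * ThetaLambert.phi (q ^ 3) =
      2 * ((∑' n : ℤ, q ^ (5 * n) / (1 + q ^ (12 * n))) +
        ∑' n : ℤ, q ^ (9 * n + 3) / (1 + q ^ (12 * n + 4))) ∧
    ThetaLambert.phi (q ^ 2) * ThetaLambert.phi (q ^ 3) =
      1 + (∑' n : ℕ+,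
        (ThetaLambert.kronecker (-6) n : ℂ) * (q ^ (n : ℕ) / (1 - q ^ (n : ℕ)))) -
        ∑' n : ℕ+, (legendreSym 3 ((n : ℕ) : ℤ) : ℂ) *
          (q ^ (n : ℕ) * (1 - q ^ (2 * (n : ℕ))) / (1 + q ^ (4 * (n : ℕ)))) := by

  obtain ⟨s1, s5, s3, s9, hP, hQ, hST, hLP, hLQ⟩ := ThetaLambert.summable_and_eq_tsum hq
  obtain ⟨hA, hB⟩ := ThetaLambert.phi_mul_phi_eq hq
  have hP' := (s1.tsum_add s5).symm.trans (tsum_congr fun n => (add_div _ _ _).symm)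
  have hQ' := (s3.tsum_sub s9).symm.trans (tsum_congr fun n => (sub_div _ _ _).symm)
  have tP := hLP.tsum_eq
  have tQ := hLQ.tsum_eq
  rw [← hP', ← hQ', tP, tQ]
  refine ⟨s1, s5, s3, s9, (s1.add s5).congr fun n => (add_div _ _ _).symm,
    (s3.sub s9).congr fun n => (sub_div _ _ _).symm, hLP.summable, hLQ.summable, hP, by ring, hQ,
    rfl, hA, ?_, ?_, ?_, ?_, hB, ?_, ?_, ?_, ?_⟩
  · rw [hA, hP, hQ]
  -- S₁ − S₅ = T₃ + T₉ eliminates one S and one T from P ± Q.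
  · rw [hA, hP, hQ]; linear_combination -hST
  · rw [hA, hP, hQ]; linear_combination hST
  · rw [hA]; ring
  · rw [hB, hP, hQ]
  · rw [hB, hP, hQ]; linear_combination -hST
  · rw [hB, hP, hQ]; linear_combination hST
  · rw [hB]; ring
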